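/- **Setting.** Let $\mathcal X=\mathbb R^m$ or $\mathcal X=[0,\infty)^m$, with interior $\mathcal X^\circ$. Consider an exponential family with densities $p(x\mid\theta)=\exp(\theta^\top t(x)-a(\theta)+b(x))$ with respect to Lebesgue measure on $\mathcal X$, with $t:\mathcal X\to\mathbb R^r$ and natural parameter space $\Omega=\{\theta\in\mathbb R^r:\int_{\mathcal X}\exp(\theta^\top t+b)\,dx<\infty\}$. Let $\theta_0\in\Omega$, let $h_1,\dots,h_m\ge 0$ be measurable weight functions on $\mathcal X$, and put $$\Gamma(x)=\sum_{j=1}^m h_j(x)\,\partial_jt(x)\,\partial_jt(x)^\top,\qquad g(x)=-\sum_{j=1}^m\big(h_j(x)\,\partial_jb(x)\,\partial_jt(x)+h_j(x)\,\partial_{jj}t(x)+\partial_jh_j(x)\,\partial_jt(x)\big).$$ **Assumptions.** 1. (Score matching.) $\Omega$ has non-empty interior (the family is $r$-dimensional); $t$ and $b$ are twice continuously differentiable on $\mathcal X^\circ$; each $h_j$ is positive almost everywhere on $\mathcal X$ and, as a function of $x_j$ alone along any line in $\mathcal X^\circ$, absolutely continuous on compact intervals. For all $\theta\in\Omega$ and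 all $j$: along every line in $\mathcal X^\circ$ in the direction of the $j$-th coordinate, $p(x\mid\theta_0)h_j(x)\,\partial_j\log p(x\mid\theta)$ has finite and equal limits at the two ends ($x_j\to\infty$, and $x_j\to-\infty$ respectively $x_j\searrow0$); and under $\theta_0$ the functions $h_j(\partial_j\log p(\cdot\mid\theta))^2$ and $\partial_jh_j\,\partial_j\log p(\cdot\mid\theta)+h_j\,\partial_{jj}\log p(\cdot\mid\theta)$ are integrable. 2. (A1) No $t_i$ is constant on $\mathcal X^\circ$. (A2) For each $j$ let $R_j=\{i:\partial_jt_i\not\equiv0\text{ on }\mathcal X^\circ\}$ and $v^{(j)}(x)=\sqrt{h_j(x)}\,(\partial_jt_i(x))_{i\in R_j}$; then for every proper linear subspace $L$ of $\mathbb R^{R_j}$ the set $\{x\in\mathcal X:v^{(j)}(x)\in L\}$ is a Lebesgue null set. 3. $\Gamma(x)$ and $g(x)$ have finite second moments when $x\sim p(\cdot\mid\theta_0)$. **Estimator.** A geometric median of points $\mu_1,\dots,\mu_K$ is any minimizer $z$ of $\sum_k\|\mu_k-z\|_2$ (matrices in $\mathbb R^{r\times r}$ are regarded as vectors in $\mathbb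 R^{r^2}$). A geometric median of means with $K$ blocks of $n$ points is a geometric median of the means of the $K$ consecutive blocks of size $\lfloor n/K\rfloor$ (the remaining points are discarded). For a sample of size $n$, let $\hat\Gamma_K$ and $\hat g_K$ be geometric medians of means with $K$ blocks of the values of $\Gamma$ and of $g$ at the observations. The robust score matching estimator minimizes $\tfrac12\theta^\top\hat\Gamma_K\theta-\theta^\top\hat g_K$; if $\hat\Gamma_K$ is positive definite, the unconstrained minimizer is $\hat\Gamma_K^{-1}\hat g_K$. **Claim.** There is a choice of block number $K=K(n_c)$, depending only on the number $n_c$ of corrupted samples, such that the following holds for every family and every $\theta_0$ as above. Let $x^{(1)},x^{(2)},\dots$ be i.i.d. with density $p(\cdot\mid\theta_0)$, let $n_c=n_c(n)=o(n)$, and for each $n$ let up to $n_c$ of the observations $x^{(1)},\dots,x^{(n)}$ be replaced arbitrarily (the choice of the replaced observations and their new values may depend on the whole sample). Then, for the estimators computed from the corrupted samples with $K=K(n_c)$ blocks, as $n\to\infty$: - $1\le K(n_c)\le n$ for all large $n$, and $\hat\Gamma_{K}$ is positive definite with probability tending to one; - $\hat\Gamma_{K}^{-1}\hat g_{K}\to\theta_0$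 in probability; - minimizers of $\tfrac12\theta^\top\hat\Gamma_{K}\theta-\theta^\top\hat g_{K}$ over $\theta\in\Omega$ are consistent: for every $\varepsilon>0$, the probability that there is such a minimizer at distance at least $\varepsilon$ from $\theta_0$ tends to zero; if $\theta_0$ is an interior point of $\Omega$, then with probability tending to one there is exactly one such minimizer, namely $\hat\Gamma_{K}^{-1}\hat g_{K}$. (Probabilities of possibly non-measurable events are understood as outer probabilities; a claim that the probability of an event tends to one means that the outer probability of its complement tends to zero.) -/

import Mathlib

open MeasureTheory ProbabilityTheory Filter Topology Asymptotics

noncomputable section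

namespace RobustSM

/-! ### Geometric median of means -/

/-- `z` is a geometric median of the points `p k`: it minimises the sum of the distances. -/
def IsGeometricMedian {V : Type*} [NormedAddCommGroup V] {K : ℕ} (p : Fin K → V) (z : V) : Prop :=
  ∀ z' : V, ∑ k, ‖p k - z‖ ≤ ∑ k, ‖p k - z'‖

/-- The `k`-th of `K` block means of `v 0, …, v (n - 1)`. The blocks are consecutive and have the
common size `⌊n / K⌋`; if `K` does not divide `n`, the last `n - K ⌊n / K⌋` points are unused. -/
def blockMean {V : Type*} [AddCommGroup V] [Module ℝ V] {n : ℕ} (K : ℕ) (v : Fin n → V)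
    (k : Fin K) : V :=
  ((n / K : ℕ) : ℝ)⁻¹ •
    ∑ i : Fin n with k.val * (n / K) ≤ i.val ∧ i.val < (k.val + 1) * (n / K), v i

/-- `z` is a geometric median of means of `v 0, …, v (n - 1)` with `K` blocks. -/
def IsGMoM {V : Type*} [NormedAddCommGroup V] [Module ℝ V] {n : ℕ} (K : ℕ) (v : Fin n → V)
    (z : V) : Prop :=
  IsGeometricMedian (blockMean K v) z

/-- An `r × r` matrix as a vector of the Euclidean space of dimension `r²`. -/
def vecMatrix {r : ℕ} (A : Matrix (Fin r) (Fin r) ℝ) : EuclideanSpace ℝ (Fin r × Fin r) :=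
  WithLp.toLp 2 (fun q => A q.1 q.2)

/-! ### Sample spaces and partial derivatives -/

/-- The two kinds of sample spaces: `ℝ^m` and `[0, ∞)^m`. -/
inductive SampleSpace : Type
  | whole
  | nonneg

/-- The sample space `ℝ^m` or `[0, ∞)^m`. -/
def SampleSpace.carrier (D : SampleSpace) (m : ℕ) : Set (EuclideanSpace ℝ (Fin m)) :=
  match D with
  | .whole => Set.univ
  | .nonneg => {x | ∀ j, 0 ≤ x j}

/-- One coordinate of the interior of the sample space: `ℝ` or `(0, ∞)`. -/
def SampleSpace.openAxis (D : SampleSpace) : Set ℝ :=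
  match D with
  | .whole => Set.univ
  | .nonneg => Set.Ioi 0

/-- The interior `ℝ^m` or `(0, ∞)^m` of the sample space. -/
def SampleSpace.openCarrier (D : SampleSpace) (m : ℕ) : Set (EuclideanSpace ℝ (Fin m)) :=
  {x | ∀ j, x j ∈ D.openAxis}

/-- The filter of a coordinate tending to its lower end: `s → -∞` or `s ↘ 0`. -/
def SampleSpace.lowerEnd (D : SampleSpace) : Filter ℝ :=
  match D with
  | .whole => atBot
  | .nonneg => 𝓝[>] 0

/-- The `j`-th partial derivative `∂_j f (x)`. -/
def pd {m : ℕ} {F : Type*} [NormedAddCommGroup F] [NormedSpace ℝ F] (j : Fin m)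
    (f : EuclideanSpace ℝ (Fin m) → F) (x : EuclideanSpace ℝ (Fin m)) : F :=
  lineDeriv ℝ f x (EuclideanSpace.single j (1 : ℝ))

/-- The point `x` with its `j`-th coordinate replaced by `s`. -/
def setCoord {m : ℕ} (j : Fin m) (x : EuclideanSpace ℝ (Fin m)) (s : ℝ) :
    EuclideanSpace ℝ (Fin m) :=
  WithLp.toLp 2 (Function.update x.ofLp j s)

/-! ### Exponential families and score matching -/

/-- The data of an exponential family on `ℝ^m` or `[0, ∞)^m` with `r` natural parameters, i.e. of
the densities `exp (θᵀ t(x) - a(θ) + b(x))`, together with the weights `h` of score matching. -/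
structure ExpFamily (m r : ℕ) where
  /-- the sample space -/
  space : SampleSpace
  /-- the sufficient statistic -/
  t : EuclideanSpace ℝ (Fin m) → EuclideanSpace ℝ (Fin r)
  /-- the log base density -/
  b : EuclideanSpace ℝ (Fin m) → ℝ
  /-- the weight functions `h 1, …, h m` -/
  h : Fin m → EuclideanSpace ℝ (Fin m) → ℝ

namespace ExpFamily

variable {m r : ℕ} (M : ExpFamily m r)

/-- The sample space of the family. -/
def X : Set (EuclideanSpace ℝ (Fin m)) := M.space.carrier m

/-- The interior of the sample space. -/
def openX : Set (EuclideanSpace ℝ (Fin m)) := M.space.openCarrier m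

/-- The natural parameter space: all `θ` for which `∫ exp (θᵀ t + b)` is finite. -/
def naturalSpace : Set (EuclideanSpace ℝ (Fin r)) :=
  {θ | IntegrableOn (fun x => Real.exp (inner ℝ θ (M.t x) + M.b x)) M.X}

/-- The log normalising constant `a(θ)`. -/
def a (θ : EuclideanSpace ℝ (Fin r)) : ℝ :=
  Real.log (∫ x in M.X, Real.exp (inner ℝ θ (M.t x) + M.b x))

/-- The log density `log p(x | θ) = θᵀ t(x) - a(θ) + b(x)`. -/
def logDensity (θ : EuclideanSpace ℝ (Fin r)) (x : EuclideanSpace ℝ (Fin m)) : ℝ :=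
  inner ℝ θ (M.t x) - M.a θ + M.b x

/-- The density `p(x | θ)`. -/
def density (θ : EuclideanSpace ℝ (Fin r)) (x : EuclideanSpace ℝ (Fin m)) : ℝ :=
  Real.exp (M.logDensity θ x)

/-- The distribution `P_θ` with density `p(· | θ)` with respect to Lebesgue measure on the sample
space. -/
def law (θ : EuclideanSpace ℝ (Fin r)) : Measure (EuclideanSpace ℝ (Fin m)) :=
  (volume.restrict M.X).withDensity (fun x => ENNReal.ofReal (M.density θ x))

/-- `Γ(x) = ∑ j, h_j(x) ∂_j t(x) ∂_j t(x)ᵀ`. -/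
def Gam (x : EuclideanSpace ℝ (Fin m)) : Matrix (Fin r) (Fin r) ℝ :=
  ∑ j, M.h j x • Matrix.vecMulVec (pd j M.t x).ofLp (pd j M.t x).ofLp

/-- `g(x) = - ∑ j, (h_j(x) ∂_j b(x) ∂_j t(x) + h_j(x) ∂_jj t(x) + ∂_j h_j(x) ∂_j t(x))`. -/
def gvec (x : EuclideanSpace ℝ (Fin m)) : EuclideanSpace ℝ (Fin r) :=
  -∑ j, ((M.h j x * pd j M.b x) • pd j M.t x + M.h j x • pd j (pd j M.t) x
    + pd j (M.h j) x • pd j M.t x)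

/-- The conditions under which generalized score matching identifies the true parameter `θ₀`. -/
structure ScoreMatchingRegular (θ₀ : EuclideanSpace ℝ (Fin r)) : Prop where
  /-- the true distribution belongs to the family -/
  mem : θ₀ ∈ M.naturalSpace
  /-- the family is `r`-dimensional -/
  full : (interior M.naturalSpace).Nonempty
  /-- the densities are twice continuously differentiable -/
  t_smooth : ContDiffOn ℝ 2 M.t M.openX
  b_smooth : ContDiffOn ℝ 2 M.b M.openX
  /-- the weights are measurable, non-negative, positive almost everywhere and, in the respective
  coordinate, locally absolutely continuous -/
  h_meas : ∀ j, Measurable (M.h j)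
  h_nonneg : ∀ j, ∀ x ∈ M.X, 0 ≤ M.h j x
  h_pos : ∀ j, ∀ᵐ x ∂(volume.restrict M.X), 0 < M.h j x
  h_absCont : ∀ j, ∀ x ∈ M.openX, ∀ c ∈ M.space.openAxis, ∀ d ∈ M.space.openAxis,
    AbsolutelyContinuousOnInterval (fun s => M.h j (setCoord j x s)) c d
  /-- `p(x | θ₀) h_j(x) ∂_j log p(x | θ)` has equal limits at the two ends of each line in the
  `j`-th coordinate direction -/
  boundary : ∀ θ ∈ M.naturalSpace, ∀ j, ∀ x ∈ M.openX, ∃ ℓ : ℝ,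
    Tendsto (fun s => M.density θ₀ (setCoord j x s) * M.h j (setCoord j x s) *
      pd j (M.logDensity θ) (setCoord j x s)) atTop (𝓝 ℓ) ∧
    Tendsto (fun s => M.density θ₀ (setCoord j x s) * M.h j (setCoord j x s) *
      pd j (M.logDensity θ) (setCoord j x s)) M.space.lowerEnd (𝓝 ℓ)
  /-- `E ‖∇ log p(x | θ) ∘ h(x)^{1/2}‖₂² < ∞` under `θ₀` -/
  score_sq : ∀ θ ∈ M.naturalSpace, ∀ j,
    Integrable (fun x => M.h j x * (pd j (M.logDensity θ) x) ^ 2) (M.law θ₀)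
  /-- `E ∑ j, |∂_j (h_j(x) ∂_j log p(x | θ))| < ∞` under `θ₀` -/
  score_deriv : ∀ θ ∈ M.naturalSpace, ∀ j,
    Integrable (fun x => pd j (M.h j) x * pd j (M.logDensity θ) x
      + M.h j x * pd j (pd j (M.logDensity θ)) x) (M.law θ₀)

/-- No component of the sufficient statistic is constant. -/
def NonconstantStatistic : Prop :=
  ∀ i : Fin r, ∃ x ∈ M.openX, ∃ y ∈ M.openX, M.t x i ≠ M.t y i

/-- `R_j`, the set of all `i` such that `∂_j t_i` is not identically zero. -/
def R (j : Fin m) : Set (Fin r) := {i | ∃ x ∈ M.openX, pd j M.t x i ≠ 0}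

/-- `v^{(j)}(x)`, the vector `√(h_j(x)) ∂_j t(x)` restricted to the components in `R_j`. -/
def v (j : Fin m) (x : EuclideanSpace ℝ (Fin m)) : M.R j → ℝ :=
  fun i => Real.sqrt (M.h j x) * pd j M.t x i.1

/-- Preimages of proper linear subspaces under every `v^{(j)}` are Lebesgue null sets. -/
def NullPreimages : Prop :=
  ∀ j, ∀ L : Submodule ℝ (M.R j → ℝ), L ≠ ⊤ → volume {x ∈ M.X | M.v j x ∈ L} = 0

/-- `Γ(x)` and `g(x)` have finite second moments under `P_θ₀`. -/
def SecondMoments (θ₀ : EuclideanSpace ℝ (Fin r)) : Prop :=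
  MemLp (fun x => vecMatrix (M.Gam x)) 2 (M.law θ₀) ∧ MemLp M.gvec 2 (M.law θ₀)

end ExpFamily

/-- The quadratic loss `½ θᵀ G θ - θᵀ g`. -/
def quadLoss {r : ℕ} (G : Matrix (Fin r) (Fin r) ℝ) (g θ : EuclideanSpace ℝ (Fin r)) : ℝ :=
  1 / 2 * (θ.ofLp ⬝ᵥ G.mulVec θ.ofLp) - θ.ofLp ⬝ᵥ g.ofLp

/-- `θ` minimises the quadratic loss over the parameter set `S`. -/
def IsLossMin {r : ℕ} (S : Set (EuclideanSpace ℝ (Fin r))) (G : Matrix (Fin r) (Fin r) ℝ)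
    (g θ : EuclideanSpace ℝ (Fin r)) : Prop :=
  θ ∈ S ∧ ∀ θ' ∈ S, quadLoss G g θ ≤ quadLoss G g θ'

/-- The vector `G⁻¹ g`. -/
def invMul {r : ℕ} (G : Matrix (Fin r) (Fin r) ℝ) (g : EuclideanSpace ℝ (Fin r)) :
    EuclideanSpace ℝ (Fin r) :=
  WithLp.toLp 2 (G⁻¹.mulVec g.ofLp)

end RobustSM

end

/-!
Integrating `p(x | θ₀) h_j(x) uᵀ ∂_j t(x)` by parts along the coordinate lines gives
`E[g] = E[Γ] θ₀`; the boundary and integrability conditions, stated for the scores of the family,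
pass to `uᵀ ∂_j t` because any `u` is a multiple of a difference of two parameters in
`naturalSpace`. The matrix `E[Γ]` is positive definite because `uᵀ E[Γ] u = 0` forces `uᵀ t` to be
constant.

A geometric median is close to any point around which more than half of the points concentrate.
With `K` blocks, `nc` corrupted observations spoil at most `nc` block means, which is a minority if
`K = 4 nc + 1`, and the block size `n / K` tends to infinity since `nc = o(n)`, so the law of large
numbers puts all but a small fraction of the clean block means near the expectation. Hence the
medians of `Γ` and `g` converge in probability to `E[Γ]` and `E[Γ] θ₀`, and uniform strong convexity
of the quadratic losses transfers this to their minimisers.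
-/

namespace RobustSM

/-! ### Geometric medians -/

section GeometricMedian

variable {V : Type*} [NormedAddCommGroup V] {K : ℕ} {p : Fin K → V} {z : V}

theorem IsGeometricMedian.mul_norm_sub_le (hz : IsGeometricMedian p z) {c : V} {ε : ℝ}
    (s : Finset (Fin K)) (hs : ∀ k ∉ s, ‖p k - c‖ ≤ ε) :
    (K - 2 * s.card) * ‖z - c‖ ≤ 2 * (K - s.card) * ε := by
  have h_outliers : ∑ k ∈ s, (‖p k - c‖ - ‖p k - z‖) ≤ s.card • ‖z - c‖ :=
    s.sum_le_card_nsmul _ _ fun k _ => by linarith [norm_sub_le_norm_sub_add_norm_sub (p k) z c]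
  have h_inliers : ∑ k ∈ sᶜ, (‖p k - c‖ - ‖p k - z‖) ≤ sᶜ.card • (2 * ε - ‖z - c‖) := by
    refine sᶜ.sum_le_card_nsmul _ _ fun k hk => ?_
    have h_triangle := norm_sub_le_norm_sub_add_norm_sub z (p k) c
    rw [norm_sub_rev z (p k)] at h_triangle
    linarith [hs k (Finset.mem_compl.1 hk)]
  have h_min : 0 ≤ ∑ k, (‖p k - c‖ - ‖p k - z‖) := by
    rw [Finset.sum_sub_distrib, sub_nonneg]
    exact hz c
  rw [← Finset.sum_add_sum_compl s] at h_min
  rw [nsmul_eq_mul] at h_outliers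
  rw [nsmul_eq_mul, Finset.card_compl, Nat.cast_sub s.card_le_univ, Fintype.card_fin] at h_inliers
  linarith

theorem IsGeometricMedian.map_eq_self [NormedSpace ℝ V] [StrictConvexSpace ℝ V] (hK : 0 < K)
    (hz : IsGeometricMedian p z) {T : V → V} (hT : Isometry T) (hp : ∀ k, T (p k) = p k) :
    T z = z := by
  by_contra! hne
  have h_equidistant (k : Fin K) : ‖p k - T z‖ = ‖p k - z‖ := by
    rw [← dist_eq_norm, ← dist_eq_norm, ← hT.dist_eq (p k) z, hp]
  have h_closer (k : Fin K) : ‖p k - (1 / 2 : ℝ) • (z + T z)‖ < ‖p k - z‖ := by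
    have h_midpoint : p k - (1 / 2 : ℝ) • (z + T z) =
        (1 / 2 : ℝ) • (p k - z + (p k - T z)) := by
      module
    rw [h_midpoint, norm_midpoint_lt_iff (h_equidistant k).symm]
    exact fun h => hne (sub_right_injective h).symm
  have : NeZero K := ⟨hK.ne'⟩
  exact (hz _).not_gt (Finset.sum_lt_sum_of_nonempty Finset.univ_nonempty fun k _ => h_closer k)

end GeometricMedian

section Matrix

variable {r : ℕ}

theorem vecMatrix_injective : Function.Injective (vecMatrix (r := r)) := fun _ _ h => by
  ext i k
  exact congrArg (fun w => w (i, k)) h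

theorem vecMatrix_transpose (A : Matrix (Fin r) (Fin r) ℝ) :
    vecMatrix A.transpose =
      LinearIsometryEquiv.piLpCongrLeft 2 ℝ ℝ (Equiv.prodComm _ _) (vecMatrix A) := rfl

theorem IsGMoM.isSymm {n K : ℕ} (hK : 0 < K) {v : Fin n → Matrix (Fin r) (Fin r) ℝ}
    (hv : ∀ i, (v i).IsSymm) {G : Matrix (Fin r) (Fin r) ℝ}
    (hG : IsGMoM K (fun i => vecMatrix (v i)) (vecMatrix G)) : G.IsSymm := by
  let τ := LinearIsometryEquiv.piLpCongrLeft 2 ℝ ℝ (Equiv.prodComm (Fin r) (Fin r))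
  refine vecMatrix_injective (IsGeometricMedian.map_eq_self hK hG τ.isometry fun k => ?_)
  simp only [blockMean, map_smul, map_sum, τ, ← vecMatrix_transpose, (hv _).eq]

theorem tendsto_of_tendsto_vecMatrix {α : Type*} {l : Filter α}
    {G : α → Matrix (Fin r) (Fin r) ℝ} {Γ : Matrix (Fin r) (Fin r) ℝ}
    (h : Tendsto (fun p => vecMatrix (G p)) l (𝓝 (vecMatrix Γ))) : Tendsto G l (𝓝 Γ) :=
  tendsto_pi_nhds.2 fun i => tendsto_pi_nhds.2 fun k =>
    ((EuclideanSpace.proj (𝕜 := ℝ) (i, k)).continuous.tendsto _).comp h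

theorem dotProduct_mulVec_eq_inner (A : Matrix (Fin r) (Fin r) ℝ) (u w : Fin r → ℝ) :
    u ⬝ᵥ A.mulVec w = inner ℝ (vecMatrix (Matrix.vecMulVec u w)) (vecMatrix A) := by
  simp only [dotProduct, Matrix.mulVec, PiLp.inner_apply, vecMatrix, Fintype.sum_prod_type,
    Matrix.vecMulVec_apply, Finset.mul_sum, RCLike.inner_apply, conj_trivial]
  exact Finset.sum_congr rfl fun i _ => Finset.sum_congr rfl fun k _ => by ring

end Matrix

/-! ### Stability of minimisers of quadratic losses -/

theorem eventually_coercive {ι : Type*} [Fintype ι] {Γ : Matrix ι ι ℝ} (hΓ : Γ.PosDef) :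
    ∃ c > 0, ∀ᶠ G in 𝓝 Γ, ∀ u : EuclideanSpace ℝ ι, c * ‖u‖ ^ 2 ≤ u.ofLp ⬝ᵥ G.mulVec u.ofLp := by
  let q (p : Matrix ι ι ℝ × EuclideanSpace ℝ ι) : ℝ := p.2.ofLp ⬝ᵥ p.1.mulVec p.2.ofLp
  have hq : Continuous q := by
    simp only [q, dotProduct, Matrix.mulVec]
    fun_prop
  have h_sphere : IsCompact (Metric.sphere (0 : EuclideanSpace ℝ ι) 1) := isCompact_sphere 0 1
  have hq_pos : ∀ u ∈ Metric.sphere (0 : EuclideanSpace ℝ ι) 1, 0 < q (Γ, u) := fun u hu => by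
    simpa [q] using hΓ.dotProduct_mulVec_pos (x := u.ofLp)
      (by simpa using ne_zero_of_mem_unit_sphere ⟨u, hu⟩)
  obtain ⟨c, hc, hqc⟩ := h_sphere.exists_forall_le' (by fun_prop) hq_pos
  have h_near : ∀ᶠ G in 𝓝 Γ, ∀ u ∈ Metric.sphere (0 : EuclideanSpace ℝ ι) 1, c / 2 < q (G, u) :=
    h_sphere.eventually_forall_of_forall_eventually fun u hu =>
      hq.continuousAt.eventually_const_lt ((half_lt_self hc).trans_le (hqc u hu))
  refine ⟨c / 2, half_pos hc, h_near.mono fun G hG u => ?_⟩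
  rcases eq_or_ne u 0 with rfl | hu
  · simp
  have h_scale : q (G, ‖u‖⁻¹ • u) = (u.ofLp ⬝ᵥ G.mulVec u.ofLp) / ‖u‖ ^ 2 := by
    simp only [q, WithLp.ofLp_smul, Matrix.mulVec_smul, smul_dotProduct, dotProduct_smul,
      smul_eq_mul]
    field_simp
  rw [← le_div_iff₀ (by positivity), ← h_scale]
  exact (hG _ (by simp [norm_smul, hu])).le

theorem posDef_of_coercive {ι : Type*} [Fintype ι] {G : Matrix ι ι ℝ} (hG : G.IsSymm) {c : ℝ}
    (hc : 0 < c) (h : ∀ u : EuclideanSpace ℝ ι, c * ‖u‖ ^ 2 ≤ u.ofLp ⬝ᵥ G.mulVec u.ofLp) :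
    G.PosDef := by
  refine Matrix.PosDef.of_dotProduct_mulVec_pos (Matrix.isHermitian_iff_isSymm.2 hG)
    fun {x} hx => ?_
  have hx_norm : 0 < ‖(WithLp.toLp 2 x : EuclideanSpace ℝ ι)‖ := by
    rw [norm_pos_iff]
    simpa using hx
  simpa using (by positivity : 0 < c * ‖(WithLp.toLp 2 x : EuclideanSpace ℝ ι)‖ ^ 2).trans_le
    (h (WithLp.toLp 2 x))

section QuadLoss

variable {r : ℕ} {G : Matrix (Fin r) (Fin r) ℝ}

theorem quadLoss_eq_add (hG : G.IsSymm) (g θ θ' : EuclideanSpace ℝ (Fin r)) :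
    quadLoss G g θ = quadLoss G g θ' + 1 / 2 * ((θ - θ').ofLp ⬝ᵥ G.mulVec (θ - θ').ofLp) +
      (θ - θ').ofLp ⬝ᵥ (G.mulVec θ'.ofLp - g.ofLp) := by
  have h_comm (u w : Fin r → ℝ) : u ⬝ᵥ G.mulVec w = w ⬝ᵥ G.mulVec u := by
    rw [Matrix.dotProduct_mulVec, ← Matrix.mulVec_transpose, hG.eq, dotProduct_comm]
  simp only [quadLoss, WithLp.ofLp_sub, Matrix.mulVec_sub, sub_dotProduct, dotProduct_sub]
  rw [h_comm θ'.ofLp θ.ofLp]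
  ring

theorem mul_dist_le_of_quadLoss_le (hG : G.IsSymm) {c : ℝ}
    (hc : ∀ u : EuclideanSpace ℝ (Fin r), c * ‖u‖ ^ 2 ≤ u.ofLp ⬝ᵥ G.mulVec u.ofLp)
    {g θ θ' : EuclideanSpace ℝ (Fin r)} (hle : quadLoss G g θ ≤ quadLoss G g θ') :
    c * dist θ θ' ≤ 2 * dist (WithLp.toLp 2 (G.mulVec θ'.ofLp)) g := by
  rw [quadLoss_eq_add hG g θ θ'] at hle
  rw [dist_eq_norm, dist_eq_norm]
  set d := θ - θ'
  set e := WithLp.toLp 2 (G.mulVec θ'.ofLp) - g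
  have h_linear : -(‖d‖ * ‖e‖) ≤ d.ofLp ⬝ᵥ (G.mulVec θ'.ofLp - g.ofLp) := by
    have := neg_le_of_abs_le (abs_real_inner_le_norm d e)
    rwa [EuclideanSpace.inner_eq_star_dotProduct, star_trivial, dotProduct_comm] at this
  have h_sq : ‖d‖ * (c * ‖d‖) ≤ ‖d‖ * (2 * ‖e‖) := by linarith [hc d]
  rcases (norm_nonneg d).eq_or_lt with hd | hd
  · rw [← hd, mul_zero]
    positivity
  · exact le_of_mul_le_mul_left h_sq hd

theorem quadLoss_eq_invMul_add (hG : G.PosDef) (g θ : EuclideanSpace ℝ (Fin r)) :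
    quadLoss G g θ = quadLoss G g (invMul G g) +
      1 / 2 * ((θ - invMul G g).ofLp ⬝ᵥ G.mulVec (θ - invMul G g).ofLp) := by
  have h_normal : G.mulVec (invMul G g).ofLp = g.ofLp := by
    simp [invMul, Matrix.mulVec_mulVec, Matrix.mul_nonsing_inv _ hG.det_pos.ne'.isUnit]
  rw [quadLoss_eq_add (Matrix.isHermitian_iff_isSymm.1 hG.isHermitian) g θ (invMul G g),
    h_normal, sub_self, dotProduct_zero, add_zero]

theorem quadLoss_invMul_le (hG : G.PosDef) (g θ : EuclideanSpace ℝ (Fin r)) :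
    quadLoss G g (invMul G g) ≤ quadLoss G g θ := by
  rw [quadLoss_eq_invMul_add hG g θ]
  simpa using hG.posSemidef.dotProduct_mulVec_nonneg (θ - invMul G g).ofLp

theorem quadLoss_invMul_lt (hG : G.PosDef) {g θ : EuclideanSpace ℝ (Fin r)}
    (hθ : θ ≠ invMul G g) : quadLoss G g (invMul G g) < quadLoss G g θ := by
  rw [quadLoss_eq_invMul_add hG g θ]
  simpa using hG.dotProduct_mulVec_pos (x := (θ - invMul G g).ofLp)
    (fun h => hθ (sub_eq_zero.1 (WithLp.ofLp_injective 2 h)))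

theorem isLossMin_iff_eq_invMul (hG : G.PosDef) {g : EuclideanSpace ℝ (Fin r)}
    {S : Set (EuclideanSpace ℝ (Fin r))} (hS : invMul G g ∈ S) (θ : EuclideanSpace ℝ (Fin r)) :
    IsLossMin S G g θ ↔ θ = invMul G g := by
  constructor
  · rintro ⟨-, hθ⟩
    by_contra hne
    exact (hθ _ hS).not_gt (quadLoss_invMul_lt hG hne)
  · rintro rfl
    exact ⟨hS, fun θ' _ => quadLoss_invMul_le hG g θ'⟩

end QuadLoss

section Limit

variable {r : ℕ} {α : Type*} {l : Filter α} {G : α → Matrix (Fin r) (Fin r) ℝ}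
  {Γ : Matrix (Fin r) (Fin r) ℝ} {g : α → EuclideanSpace ℝ (Fin r)}
  {θ₀ : EuclideanSpace ℝ (Fin r)}

theorem eventually_posDef (hΓ : Γ.PosDef) (hG : Tendsto G l (𝓝 Γ))
    (hsymm : ∀ᶠ p in l, (G p).IsSymm) : ∀ᶠ p in l, (G p).PosDef := by
  obtain ⟨c, hc, h_coercive⟩ := eventually_coercive hΓ
  filter_upwards [hG.eventually h_coercive, hsymm] with p hp hp_symm
  exact posDef_of_coercive hp_symm hc hp

theorem eventually_dist_lt_of_quadLoss_le (hΓ : Γ.PosDef) (hG : Tendsto G l (𝓝 Γ))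
    (hsymm : ∀ᶠ p in l, (G p).IsSymm)
    (hg : Tendsto g l (𝓝 (WithLp.toLp 2 (Γ.mulVec θ₀.ofLp)))) {ε : ℝ} (hε : 0 < ε) :
    ∀ᶠ p in l, ∀ θ, quadLoss (G p) (g p) θ ≤ quadLoss (G p) (g p) θ₀ → dist θ θ₀ < ε := by
  obtain ⟨c, hc, h_coercive⟩ := eventually_coercive hΓ
  have h_mulVec : Continuous fun A : Matrix (Fin r) (Fin r) ℝ =>
      (WithLp.toLp 2 (A.mulVec θ₀.ofLp) : EuclideanSpace ℝ (Fin r)) := by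
    fun_prop
  have h_residual : Tendsto (fun p => dist (WithLp.toLp 2 ((G p).mulVec θ₀.ofLp)) (g p)) l
      (𝓝 0) := by
    simpa using ((h_mulVec.tendsto Γ).comp hG).dist hg
  filter_upwards [hG.eventually h_coercive, hsymm,
    h_residual.eventually_lt_const (by positivity : 0 < c * ε / 2)] with p hp hp_symm hp_res θ hθ
  refine lt_of_mul_lt_mul_left ?_ hc.le
  linarith [mul_dist_le_of_quadLoss_le hp_symm hp hθ]

theorem tendsto_invMul (hΓ : Γ.PosDef) (hG : Tendsto G l (𝓝 Γ))
    (hsymm : ∀ᶠ p in l, (G p).IsSymm)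
    (hg : Tendsto g l (𝓝 (WithLp.toLp 2 (Γ.mulVec θ₀.ofLp)))) :
    Tendsto (fun p => invMul (G p) (g p)) l (𝓝 θ₀) :=
  Metric.tendsto_nhds.2 fun _ hε => by
    filter_upwards [eventually_posDef hΓ hG hsymm,
      eventually_dist_lt_of_quadLoss_le hΓ hG hsymm hg hε] with p hp_pos hp
    exact hp _ (quadLoss_invMul_le hp_pos _ _)

end Limit

/-! ### Events with probability tending to one -/

section WithHighProbability

variable {ι Ω : Type*} [MeasurableSpace Ω] {μ : Measure Ω} {l : Filter ι}

/-- The filter of events, depending on `i`, whose probability tends to one along `l`: `S` belongs to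
it if the outer measure of the complement of the `i`-th slice of `S` tends to zero. Limits along
this filter are limits in probability. -/
def whp (μ : Measure Ω) (l : Filter ι) : Filter (ι × Ω) where
  sets := {S | Tendsto (fun i => μ {ω | (i, ω) ∉ S}) l (𝓝 0)}
  univ_sets := by simpa using tendsto_const_nhds
  sets_of_superset {S T} hS hST :=
    tendsto_of_tendsto_of_tendsto_of_le_of_le tendsto_const_nhds hS (fun _ => zero_le)
      fun i => measure_mono fun _ hω hωS => hω (hST hωS)
  inter_sets {S T} hS hT := by
    have h_add := Tendsto.add hS hT
    rw [add_zero] at h_add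
    refine tendsto_of_tendsto_of_tendsto_of_le_of_le tendsto_const_nhds h_add (fun _ => zero_le)
      fun i => (measure_mono fun ω hω => ?_).trans (measure_union_le _ _)
    exact not_and_or.1 hω

theorem eventually_whp {P : ι × Ω → Prop} :
    (∀ᶠ p in whp μ l, P p) ↔ Tendsto (fun i => μ {ω | ¬ P (i, ω)}) l (𝓝 0) := Iff.rfl

theorem eventually_whp_of_ae {P : ι × Ω → Prop} (h : ∀ᶠ i in l, ∀ᵐ ω ∂μ, P (i, ω)) :
    ∀ᶠ p in whp μ l, P p :=
  eventually_whp.2 (tendsto_const_nhds.congr' (h.mono fun _ hi => (ae_iff.1 hi).symm))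

theorem tendstoInMeasure_const_iff {E : Type*} [PseudoEMetricSpace E] {f : ι → Ω → E} {a : E} :
    TendstoInMeasure μ f l (fun _ => a) ↔ Tendsto (fun p => f p.1 p.2) (whp μ l) (𝓝 a) := by
  simp only [TendstoInMeasure, EMetric.tendsto_nhds, eventually_whp, not_lt]

end WithHighProbability

/-! ### Geometric medians of means -/

/-- The mean of the `k`-th block of `B` consecutive terms of an infinite sequence. -/
noncomputable def seqBlockMean {V : Type*} [AddCommGroup V] [Module ℝ V] (w : ℕ → V)
    (B k : ℕ) : V :=
  (B : ℝ)⁻¹ • ∑ i ∈ Finset.range B, w (k * B + i)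

theorem blockMean_eq_seqBlockMean {V : Type*} [AddCommGroup V] [Module ℝ V] {n K : ℕ}
    {v : Fin n → V} {w : ℕ → V} {k : Fin K}
    (h : ∀ i : Fin n, i.val / (n / K) = k.val → v i = w i) :
    blockMean K v k = seqBlockMean w (n / K) k := by
  rcases (n / K).eq_zero_or_pos with hB | hB
  · simp [blockMean, seqBlockMean, hB]
  have h_block : k.val * (n / K) + n / K ≤ n := by
    rw [← Nat.succ_mul]
    exact (Nat.mul_le_mul_right _ k.isLt).trans (Nat.mul_div_le n K)
  have h_range : ∑ i ∈ Finset.range (n / K), w (k.val * (n / K) + i) =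
      ∑ i ∈ Finset.Ico (k.val * (n / K)) (k.val * (n / K) + n / K), w i := by
    rw [Finset.sum_Ico_eq_sum_range, Nat.add_sub_cancel_left]
  rw [blockMean, seqBlockMean, h_range]
  congr 1
  refine Finset.sum_nbij Fin.val (fun i hi => ?_) Fin.val_injective.injOn (fun i hi => ?_)
    fun i hi => ?_
  · simpa [Nat.succ_mul] using hi
  · rw [Finset.coe_Ico, Set.mem_Ico] at hi
    exact ⟨⟨i, by omega⟩, by simpa [Nat.succ_mul] using hi, rfl⟩
  · rw [Finset.mem_filter] at hi
    rw [Nat.succ_mul] at hi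
    exact h i ((Nat.div_eq_iff hB).2 ⟨by omega, by omega⟩)

theorem ncard_corrupted_blocks_le {V : Type*} [AddCommGroup V] [Module ℝ V] {n : ℕ} (K : ℕ)
    (v : Fin n → V) (w : ℕ → V) :
    {k : Fin K | blockMean K v k ≠ seqBlockMean w (n / K) k}.ncard ≤
      {i : Fin n | v i ≠ w i}.ncard := by
  have h_subset : Fin.val '' {k : Fin K | blockMean K v k ≠ seqBlockMean w (n / K) k} ⊆
      (fun i : Fin n => i.val / (n / K)) '' {i : Fin n | v i ≠ w i} := by
    rintro _ ⟨k, hk, rfl⟩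
    by_contra! h_intact
    exact hk (blockMean_eq_seqBlockMean fun i hi => by_contra fun hne => h_intact ⟨i, hne, hi⟩)
  rw [← Set.ncard_image_of_injective _ Fin.val_injective]
  exact (Set.ncard_le_ncard h_subset).trans (Set.ncard_image_le)

theorem IsGMoM.mul_norm_sub_le {V : Type*} [NormedAddCommGroup V] [NormedSpace ℝ V] {n K : ℕ}
    {v : Fin n → V} {z : V} (hz : IsGMoM K v z) (w : ℕ → V) (a : V) {ε : ℝ} (hε : 0 ≤ ε) :
    (K - 2 * ({i : Fin n | v i ≠ w i}.ncard +
        {k : Fin K | ε ≤ ‖seqBlockMean w (n / K) k - a‖}.ncard : ℝ)) * ‖z - a‖ ≤ 2 * K * ε := by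
  classical
  set C := {k : Fin K | blockMean K v k ≠ seqBlockMean w (n / K) k}
  set D := {k : Fin K | ε ≤ ‖seqBlockMean w (n / K) k - a‖}
  have h_card : ((C ∪ D).toFinset.card : ℝ) ≤ {i : Fin n | v i ≠ w i}.ncard + D.ncard := by
    rw [← Set.ncard_eq_toFinset_card']
    exact_mod_cast (Set.ncard_union_le C D).trans
      (Nat.add_le_add_right (ncard_corrupted_blocks_le K v w) _)
  have h_median := IsGeometricMedian.mul_norm_sub_le hz (C ∪ D).toFinset fun k hk => by
    rw [Set.mem_toFinset, Set.mem_union, not_or] at hk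
    rw [not_not.1 hk.1]
    exact (not_le.1 hk.2).le
  calc _ ≤ ((K : ℝ) - 2 * (C ∪ D).toFinset.card) * ‖z - a‖ := by gcongr
    _ ≤ 2 * (K - (C ∪ D).toFinset.card) * ε := h_median
    _ ≤ 2 * K * ε := by gcongr; simp

/-! ### Consistency of geometric medians of means -/

theorem mul_measure_le_ncard_le {Ω κ : Type*} [MeasurableSpace Ω] {μ : Measure Ω} [Fintype κ]
    {A : κ → Set Ω} (hA : ∀ k, NullMeasurableSet (A k) μ) (β : ENNReal) :
    β * μ {ω | β ≤ ({k | ω ∈ A k}.ncard : ENNReal)} ≤ ∑ k, μ (A k) := by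
  classical
  have h_count (ω : Ω) : ({k | ω ∈ A k}.ncard : ENNReal) =
      ∑ k, (A k).indicator (fun _ => 1) ω := by
    rw [Set.ncard_eq_toFinset_card', Set.toFinset_ofPred, Finset.card_filter, Nat.cast_sum]
    simp only [Set.indicator_apply, Nat.cast_ite, Nat.cast_one, Nat.cast_zero]
  have h_meas (k : κ) : AEMeasurable ((A k).indicator fun _ => (1 : ENNReal)) μ :=
    aemeasurable_const.indicator₀ (hA k)
  simp only [h_count]
  refine (mul_meas_ge_le_lintegral₀ (Finset.aemeasurable_fun_sum _ fun k _ => h_meas k) β).trans ?_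
  rw [lintegral_finsetSum' _ fun k _ => h_meas k]
  exact Finset.sum_le_sum fun k _ => by rw [lintegral_indicator₀ (hA k), setLIntegral_one]

section Probability

variable {V : Type*} [NormedAddCommGroup V] [NormedSpace ℝ V]
  [MeasurableSpace V] [BorelSpace V] [SecondCountableTopology V]
  {Ω : Type*} [MeasurableSpace Ω] {μ : Measure Ω} {Z : ℕ → Ω → V}

theorem identDistrib_seqBlockMean (hZ : iIndepFun Z μ)
    (hident : ∀ i, IdentDistrib (Z i) (Z 0) μ μ) (B k : ℕ) :
    IdentDistrib (fun ω => seqBlockMean (fun i => Z i ω) B k)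
      (fun ω => seqBlockMean (fun i => Z i ω) B 0) μ μ := by
  have h_shift : IdentDistrib (fun ω i => Z (k * B + i) ω) (fun ω i => Z i ω) μ μ :=
    IdentDistrib.pi (fun i => (hident (k * B + i)).trans (hident i).symm)
      (hZ.precomp (add_right_injective (k * B))) hZ
  have h_mean : Measurable fun y : ℕ → V => (B : ℝ)⁻¹ • ∑ i ∈ Finset.range B, y i := by
    fun_prop
  simpa [seqBlockMean, Function.comp_def] using h_shift.comp h_mean

theorem mul_measure_ncard_deviations_ge_le (hZ : iIndepFun Z μ)
    (hident : ∀ i, IdentDistrib (Z i) (Z 0) μ μ) (a : V) (ε β : ℝ) {K : ℕ} (hK : 0 < K) (B : ℕ) :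
    ENNReal.ofReal β * μ {ω | β * K ≤
        {k : Fin K | ε ≤ ‖seqBlockMean (fun i => Z i ω) B k - a‖}.ncard} ≤
      μ {ω | ε ≤ ‖seqBlockMean (fun i => Z i ω) B 0 - a‖} := by
  have h_dev : MeasurableSet {y : V | ε ≤ ‖y - a‖} := measurableSet_le (by fun_prop) (by fun_prop)
  have h_ident := identDistrib_seqBlockMean hZ hident B
  have h_prob (k : ℕ) : μ {ω | ε ≤ ‖seqBlockMean (fun i => Z i ω) B k - a‖} =
      μ {ω | ε ≤ ‖seqBlockMean (fun i => Z i ω) B 0 - a‖} := (h_ident k).measure_mem_eq h_dev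
  have h_markov := mul_measure_le_ncard_le
    (A := fun k : Fin K => {ω | ε ≤ ‖seqBlockMean (fun i => Z i ω) B k - a‖})
    (fun k => (h_ident k).aemeasurable_fst.nullMeasurableSet_preimage h_dev)
    (ENNReal.ofReal (β * K))
  rw [Finset.sum_congr rfl fun (k : Fin K) _ => h_prob k, Finset.sum_const, Finset.card_univ,
    Fintype.card_fin, nsmul_eq_mul] at h_markov
  have hK' : (K : ENNReal) ≠ 0 := by exact_mod_cast hK.ne'
  rw [← ENNReal.mul_le_mul_iff_right hK' (ENNReal.natCast_ne_top K)]
  refine le_trans ?_ h_markov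
  rw [← mul_assoc, mul_comm (K : ENNReal), ENNReal.ofReal_mul' K.cast_nonneg,
    ENNReal.ofReal_natCast]
  gcongr with ω
  intro hω
  rw [← ENNReal.ofReal_natCast, ← ENNReal.ofReal_natCast, ← ENNReal.ofReal_mul' K.cast_nonneg]
  exact ENNReal.ofReal_le_ofReal hω

theorem eventually_block_number_admissible {k : ℕ → ℕ}
    (hk : Tendsto (fun n => n / k n) atTop atTop) : ∀ᶠ n in atTop, 1 ≤ k n ∧ k n ≤ n :=
  (hk.eventually_gt_atTop 0).mono fun _ hn => Nat.div_pos_iff.1 hn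

theorem eventually_ncard_deviations_lt [CompleteSpace V] [IsProbabilityMeasure μ]
    (hZ : iIndepFun Z μ) (hident : ∀ i, IdentDistrib (Z i) (Z 0) μ μ) (hint : Integrable (Z 0) μ)
    {k : ℕ → ℕ} (hk : Tendsto (fun n => n / k n) atTop atTop) {ε β : ℝ} (hε : 0 < ε) (hβ : 0 < β) :
    ∀ᶠ p : ℕ × Ω in whp μ atTop, ({j : Fin (k p.1) |
      ε ≤ ‖seqBlockMean (fun i => Z i p.2) (p.1 / k p.1) j - ∫ ω, Z 0 ω ∂μ‖}.ncard : ℝ) <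
        β * k p.1 := by
  have h_mean : TendstoInMeasure μ (fun B ω => seqBlockMean (fun i => Z i ω) B 0) atTop
      fun _ => ∫ ω, Z 0 ω ∂μ := by
    refine tendstoInMeasure_of_tendsto_ae (fun B => ?_) ?_
    · exact (Finset.aestronglyMeasurable_fun_sum _ fun i _ =>
        (hident _).aemeasurable_fst.aestronglyMeasurable).const_smul _
    · simpa only [seqBlockMean, zero_mul, zero_add] using
        strong_law_ae Z hint (fun i j hij => hZ.indepFun hij) hident
  have hβ' : ENNReal.ofReal β ≠ 0 := (ENNReal.ofReal_pos.2 hβ).ne'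
  have h_bound := ENNReal.Tendsto.div_const
    ((tendstoInMeasure_iff_norm.1 h_mean ε hε).comp hk) (b := ENNReal.ofReal β) (.inr hβ')
  rw [ENNReal.zero_div] at h_bound
  refine eventually_whp.2 (tendsto_of_tendsto_of_tendsto_of_le_of_le' tendsto_const_nhds h_bound
    (.of_forall fun _ => zero_le) ?_)
  filter_upwards [eventually_block_number_admissible hk] with n hn
  rw [ENNReal.le_div_iff_mul_le (.inl hβ') (.inl ENNReal.ofReal_ne_top), mul_comm]
  simp only [not_lt]
  exact mul_measure_ncard_deviations_ge_le hZ hident _ ε β hn.1 (n / k n)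

theorem tendsto_of_isGMoM [CompleteSpace V] [IsProbabilityMeasure μ] (hZ : iIndepFun Z μ)
    (hident : ∀ i, IdentDistrib (Z i) (Z 0) μ μ) (hint : Integrable (Z 0) μ) {nc k : ℕ → ℕ}
    (hk : Tendsto (fun n => n / k n) atTop atTop) {α : ℝ} (hα : α < 1 / 2)
    (hnc : ∀ᶠ n in atTop, (nc n : ℝ) ≤ α * k n) {W : (n : ℕ) → Fin n → Ω → V}
    (hW : ∀ n, ∀ᵐ ω ∂μ, {i : Fin n | W n i ω ≠ Z i ω}.ncard ≤ nc n) {z : ℕ → Ω → V}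
    (hz : ∀ n ω, IsGMoM (k n) (fun i => W n i ω) (z n ω)) :
    Tendsto (fun p => z p.1 p.2) (whp μ atTop) (𝓝 (∫ ω, Z 0 ω ∂μ)) := by
  refine Metric.tendsto_nhds.2 fun η hη => ?_
  -- With a fraction of at most `α` corrupted and fewer than `β` deviating blocks, more than half
  -- of the blocks are within `ε` of the mean, by a margin of `β`.
  let β := (1 / 2 - α) / 2
  let ε := β * η / 2
  have hβ : 0 < β := half_pos (sub_pos.2 hα)
  have hε : 0 < ε := by positivity
  have h_admissible : ∀ᶠ n in atTop, (0 : ℝ) < k n ∧ (nc n : ℝ) ≤ α * k n :=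
    ((eventually_block_number_admissible hk).mono fun n hn => Nat.cast_pos.2 hn.1).and hnc
  have h_corrupted : ∀ᶠ p : ℕ × Ω in whp μ atTop, (0 : ℝ) < k p.1 ∧
      ({i : Fin p.1 | W p.1 i p.2 ≠ Z i p.2}.ncard : ℝ) ≤ α * k p.1 :=
    eventually_whp_of_ae <| h_admissible.mono fun n hn => (hW n).mono fun ω hω =>
      ⟨hn.1, (Nat.cast_le.2 hω).trans hn.2⟩
  filter_upwards [h_corrupted, eventually_ncard_deviations_lt hZ hident hint hk hε hβ]
    with ⟨n, ω⟩ ⟨hk_pos, h_corr⟩ h_dev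
  have h_gmom := (hz n ω).mul_norm_sub_le (fun i => Z i ω) (∫ ω, Z 0 ω ∂μ) hε.le
  rw [dist_eq_norm]
  have h_majority : 2 * β * k n * ‖z n ω - ∫ ω, Z 0 ω ∂μ‖ ≤ 2 * k n * ε := by
    refine le_trans (mul_le_mul_of_nonneg_right ?_ (norm_nonneg _)) h_gmom
    simp only [β] at h_dev ⊢
    linarith
  have h_cancel : 2 * β * k n * ‖z n ω - ∫ ω, Z 0 ω ∂μ‖ ≤ 2 * β * k n * (η / 2) :=
    h_majority.trans_eq (by ring)
  linarith [le_of_mul_le_mul_left h_cancel (by positivity)]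

theorem tendsto_of_isGMoM_comp [CompleteSpace V] [IsProbabilityMeasure μ] {𝓧 : Type*}
    [MeasurableSpace 𝓧] {P : Measure 𝓧} {f : 𝓧 → V} (hf : Integrable f P) {X : ℕ → Ω → 𝓧}
    (hX : iIndepFun X μ) (hlaw : ∀ i, HasLaw (X i) P μ) {nc k : ℕ → ℕ}
    (hk : Tendsto (fun n => n / k n) atTop atTop) {α : ℝ} (hα : α < 1 / 2)
    (hnc : ∀ᶠ n in atTop, (nc n : ℝ) ≤ α * k n) {Y : (n : ℕ) → Fin n → Ω → 𝓧}
    (hY : ∀ n, ∀ᵐ ω ∂μ, {i : Fin n | Y n i ω ≠ X i ω}.ncard ≤ nc n) {z : ℕ → Ω → V}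
    (hz : ∀ n ω, IsGMoM (k n) (fun i => f (Y n i ω)) (z n ω)) :
    Tendsto (fun p => z p.1 p.2) (whp μ atTop) (𝓝 (∫ x, f x ∂P)) := by
  have hfX (i : ℕ) : AEMeasurable f (μ.map (X i)) := by
    rw [(hlaw i).map_eq]
    exact hf.aestronglyMeasurable.aemeasurable
  have hident (i : ℕ) : IdentDistrib (f ∘ X i) (f ∘ X 0) μ μ :=
    IdentDistrib.comp_of_aemeasurable ⟨(hlaw i).aemeasurable, (hlaw 0).aemeasurable,
      (hlaw i).map_eq.trans (hlaw 0).map_eq.symm⟩ (hfX i)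
  have hint : Integrable (f ∘ X 0) μ :=
    Integrable.comp_aemeasurable ((hlaw 0).map_eq.symm ▸ hf) (hlaw 0).aemeasurable
  have hfY (n : ℕ) : ∀ᵐ ω ∂μ, {i : Fin n | f (Y n i ω) ≠ (f ∘ X i) ω}.ncard ≤ nc n :=
    (hY n).mono fun ω hω =>
      (Set.ncard_le_ncard fun _ hi => mt (congrArg f) hi).trans hω
  rw [← (hlaw 0).integral_comp hf.aestronglyMeasurable]
  exact tendsto_of_isGMoM (hX.comp₀ (fun _ => f) (fun i => (hlaw i).aemeasurable) hfX) hident hint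
    hk hα hnc hfY hz

end Probability

theorem tendsto_block_size {nc : ℕ → ℕ} (hnc : (fun n => (nc n : ℝ)) =o[atTop] fun n => (n : ℝ)) :
    Tendsto (fun n => n / (4 * nc n + 1)) atTop atTop := by
  refine tendsto_atTop.2 fun b => ?_
  have h_bound := hnc.bound (c := 1 / (8 * (b + 1))) (by positivity)
  filter_upwards [h_bound, eventually_ge_atTop (2 * (b + 1))] with n hn hb
  rw [RCLike.norm_natCast, RCLike.norm_natCast, div_mul_eq_mul_div, one_mul,
    le_div_iff₀ (by positivity)] at hn
  have hn' : nc n * (8 * (b + 1)) ≤ n := by exact_mod_cast hn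
  rw [Nat.le_div_iff_mul_le (by omega)]
  linarith

/-! ### Integration by parts along coordinate lines -/

theorem setCoord_eq_add {m : ℕ} (j : Fin m) (x : EuclideanSpace ℝ (Fin m)) (s : ℝ) :
    setCoord j x s = x + (s - x j) • EuclideanSpace.single j (1 : ℝ) := by
  ext i
  rcases eq_or_ne i j with rfl | hij
  · simp [setCoord]
  · simp [setCoord, hij]

theorem setCoord_add {m : ℕ} (j : Fin m) (x : EuclideanSpace ℝ (Fin m)) (s c : ℝ) :
    setCoord j x (s + c) = setCoord j x s + c • EuclideanSpace.single j (1 : ℝ) := by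
  rw [setCoord_eq_add, setCoord_eq_add]
  module

theorem setCoord_setCoord {m : ℕ} (j : Fin m) (x : EuclideanSpace ℝ (Fin m)) (s c : ℝ) :
    setCoord j (setCoord j x c) s = setCoord j x s := by
  simp [setCoord]

theorem contDiff_setCoord {m : ℕ} (j : Fin m) (x : EuclideanSpace ℝ (Fin m)) {k : WithTop ℕ∞} :
    ContDiff ℝ k (setCoord j x) := by
  rw [funext (setCoord_eq_add j x)]
  fun_prop

theorem pd_setCoord {m : ℕ} {F : Type*} [NormedAddCommGroup F] [NormedSpace ℝ F] (j : Fin m)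
    (f : EuclideanSpace ℝ (Fin m) → F) (x : EuclideanSpace ℝ (Fin m)) (s : ℝ) :
    pd j f (setCoord j x s) = deriv (fun c => f (setCoord j x c)) s := by
  rw [pd, lineDeriv]
  simp only [← setCoord_add]
  rw [deriv_comp_const_add (fun c => f (setCoord j x c)) s 0, add_zero]

theorem hasDerivAt_comp_setCoord {m : ℕ} {F : Type*} [NormedAddCommGroup F] [NormedSpace ℝ F]
    {f : EuclideanSpace ℝ (Fin m) → F} {j : Fin m} {x : EuclideanSpace ℝ (Fin m)} {s : ℝ}
    (hf : DifferentiableAt ℝ f (setCoord j x s)) :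
    HasDerivAt (fun c => f (setCoord j x c)) (pd j f (setCoord j x s)) s := by
  rw [pd_setCoord]
  have hline : Differentiable ℝ (setCoord j x) := (contDiff_setCoord j x).differentiable_one
  exact (hf.comp s (hline s)).hasDerivAt

theorem integral_eq_zero_of_lines {m : ℕ} {E : Type*} [NormedAddCommGroup E] [NormedSpace ℝ E]
    (j : Fin m) {F : EuclideanSpace ℝ (Fin m) → E} (hF : Integrable F)
    (h : ∀ x, Integrable (fun s => F (setCoord j x s)) → ∫ s, F (setCoord j x s) = 0) :
    ∫ x, F x = 0 := by
  obtain _ | n := m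
  · exact j.elim0
  let φ : ℝ × (Fin n → ℝ) ≃ᵐ EuclideanSpace ℝ (Fin (n + 1)) :=
    (MeasurableEquiv.piFinSuccAbove (fun _ => ℝ) j).symm.trans (MeasurableEquiv.toLp 2 _)
  have hφ : MeasurePreserving φ (volume.prod volume) volume :=
    (PiLp.volume_preserving_toLp (Fin (n + 1))).comp
      (volume_preserving_piFinSuccAbove (fun _ : Fin (n + 1) => ℝ) j).symm
  have hline (s : ℝ) (y : Fin n → ℝ) :
      φ (s, y) = setCoord j (WithLp.toLp 2 (j.insertNth 0 y)) s := by
    ext i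
    simp only [setCoord, Fin.update_insertNth]
    rfl
  have hFφ : Integrable (F ∘ φ) (volume.prod volume) :=
    (hφ.integrable_comp_emb φ.measurableEmbedding).2 hF
  rw [← hφ.integral_comp φ.measurableEmbedding]
  refine (integral_prod_symm _ hFφ).trans (integral_eq_zero_of_ae ?_)
  filter_upwards [hFφ.prod_left_ae] with y hy
  simp only [Function.comp_def, hline] at hy ⊢
  exact h _ hy

theorem ae_differentiableAt_of_absolutelyContinuousOnInterval {f : ℝ → ℝ} {A : Set ℝ}
    (hA : IsOpen A) (hf : ∀ c ∈ A, ∀ d ∈ A, AbsolutelyContinuousOnInterval f c d) :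
    ∀ᵐ s, s ∈ A → DifferentiableAt ℝ f s := by
  refine measure_null_of_locally_null _ fun s hs => ?_
  have hsA : s ∈ A := by_contra fun h => hs fun hsA => (h hsA).elim
  obtain ⟨c, d, hscd, hnhds, hsub⟩ := exists_Icc_mem_subset_of_mem_nhds (hA.mem_nhds hsA)
  have hcd : c ≤ d := hscd.1.trans hscd.2
  have hdiff := (hf c (hsub (Set.left_mem_Icc.2 hcd)) d
    (hsub (Set.right_mem_Icc.2 hcd))).ae_differentiableAt
  rw [Set.uIcc_of_le hcd] at hdiff
  refine ⟨_, inter_mem (mem_nhdsWithin_of_mem_nhds hnhds) self_mem_nhdsWithin,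
    measure_mono_null ?_ hdiff⟩
  exact fun x hx h => hx.2 fun _ => h hx.1

namespace SampleSpace

variable (D : SampleSpace)

theorem isOpen_openAxis : IsOpen D.openAxis := by
  cases D
  exacts [isOpen_univ, isOpen_Ioi]

theorem uIcc_subset_openAxis {c d : ℝ} (hc : c ∈ D.openAxis) (hd : d ∈ D.openAxis) :
    Set.uIcc c d ⊆ D.openAxis := by
  cases D
  exacts [Set.subset_univ _, Set.ordConnected_Ioi.uIcc_subset hc hd]

theorem one_mem_openAxis : 1 ∈ D.openAxis := by
  cases D
  exacts [trivial, one_pos (α := ℝ)]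

theorem eventually_lowerEnd : ∀ᶠ s in D.lowerEnd, s ∈ D.openAxis ∧ s ≤ 1 := by
  cases D
  · exact (eventually_le_atBot 1).mono fun s hs => ⟨trivial, hs⟩
  · exact (Ioc_mem_nhdsGT one_pos : Set.Ioc (0 : ℝ) 1 ∈ 𝓝[>] 0)

theorem eventually_atTop : ∀ᶠ s in atTop, s ∈ D.openAxis ∧ 1 ≤ s :=
  (eventually_ge_atTop 1).mono fun _ hs =>
    ⟨D.uIcc_subset_openAxis D.one_mem_openAxis (by cases D; exacts [trivial, one_pos.trans_le hs])
      Set.right_mem_uIcc, hs⟩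

instance : D.lowerEnd.NeBot := by
  cases D
  exacts [inferInstanceAs (atBot : Filter ℝ).NeBot, inferInstanceAs (𝓝[>] (0 : ℝ)).NeBot]

instance : D.lowerEnd.IsCountablyGenerated := by
  cases D
  exacts [inferInstanceAs (atBot : Filter ℝ).IsCountablyGenerated,
    inferInstanceAs (𝓝[>] (0 : ℝ)).IsCountablyGenerated]

theorem aecover_Ioc : AECover (volume.restrict D.openAxis) (D.lowerEnd ×ˢ atTop)
    fun p : ℝ × ℝ => Set.Ioc p.1 p.2 := by
  cases D
  · rw [openAxis, Measure.restrict_univ]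
    exact MeasureTheory.aecover_Ioc tendsto_fst tendsto_snd
  · have hfst : Tendsto Prod.fst ((𝓝[>] (0 : ℝ)) ×ˢ (atTop : Filter ℝ)) (𝓝 0) :=
      tendsto_fst.mono_right nhdsWithin_le_nhds
    exact (aecover_Ioi_of_Ioi hfst).inter
      ((aecover_Iic tendsto_snd).mono Measure.restrict_le_self)

theorem integral_deriv_eq_zero {f : ℝ → ℝ}
    (hf : ∀ c ∈ D.openAxis, ∀ d ∈ D.openAxis, AbsolutelyContinuousOnInterval f c d)
    (hint : IntegrableOn (deriv f) D.openAxis) {l : ℝ} (htop : Tendsto f atTop (𝓝 l))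
    (hlow : Tendsto f D.lowerEnd (𝓝 l)) : ∫ s in D.openAxis, deriv f s = 0 := by
  have hcover := D.aecover_Ioc.integral_tendsto_of_countably_generated hint
  have hends : Tendsto (fun p : ℝ × ℝ => f p.2 - f p.1) (D.lowerEnd ×ˢ atTop) (𝓝 0) := by
    simpa only [sub_self, Function.comp_def] using
      (htop.comp tendsto_snd).sub (hlow.comp tendsto_fst)
  refine tendsto_nhds_unique hcover (hends.congr' ?_)
  filter_upwards [D.eventually_lowerEnd.prod_mk D.eventually_atTop] with p hp
  obtain ⟨⟨hc, hc1⟩, hd, hd1⟩ := hp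
  have hcd : p.1 ≤ p.2 := hc1.trans hd1
  have hsub : Set.Ioc p.1 p.2 ⊆ D.openAxis :=
    Set.Ioc_subset_Icc_self.trans (Set.Icc_subset_uIcc.trans (D.uIcc_subset_openAxis hc hd))
  rw [Measure.restrict_restrict measurableSet_Ioc, Set.inter_eq_left.2 hsub,
    ← intervalIntegral.integral_of_le hcd, (hf _ hc _ hd).integral_deriv_eq_sub]

variable (m : ℕ)

theorem isOpen_openCarrier : IsOpen (D.openCarrier m) := by
  simp only [openCarrier, Set.ofPred_forall]
  exact isOpen_iInter_of_finite fun j => D.isOpen_openAxis.preimage (by fun_prop)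

theorem convex_openCarrier : Convex ℝ (D.openCarrier m) := by
  cases D
  · exact fun _ _ _ _ _ _ _ _ _ _ => trivial
  · exact fun x hx y hy a b ha hb hab j => convex_Ioi 0 (hx j) (hy j) ha hb hab

theorem nonempty_openCarrier : (D.openCarrier m).Nonempty :=
  ⟨WithLp.toLp 2 fun _ => 1, fun _ => D.one_mem_openAxis⟩

theorem openCarrier_subset : D.openCarrier m ⊆ D.carrier m := by
  cases D
  exacts [Set.subset_univ _, fun x hx j => (hx j).le]

theorem openCarrier_ae_eq : D.openCarrier m =ᵐ[volume] D.carrier m := by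
  refine (D.openCarrier_subset m).eventuallyLE.antisymm ?_
  rw [ae_le_set]
  cases D with
  | whole => simp [openCarrier, openAxis]
  | nonneg =>
    let proj (j : Fin m) : EuclideanSpace ℝ (Fin m) →L[ℝ] ℝ := EuclideanSpace.proj j
    have hsub : nonneg.carrier m \ nonneg.openCarrier m ⊆ ⋃ j, ((proj j).ker : Set _) := by
      rintro x ⟨hx, hx'⟩
      obtain ⟨j, hj⟩ := not_forall.1 hx'
      exact Set.mem_iUnion.2 ⟨j, le_antisymm (not_lt.1 hj) (hx j)⟩
    refine measure_mono_null hsub (measure_iUnion_null fun j => ?_)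
    refine Measure.addHaar_submodule _ _ fun htop => ?_
    have hsingle : EuclideanSpace.single j (1 : ℝ) ∈ (proj j).ker := htop ▸ Submodule.mem_top
    simp [proj] at hsingle

variable {m}

theorem setCoord_mem_openCarrier_iff {j : Fin m} {x : EuclideanSpace ℝ (Fin m)}
    (hx : x ∈ D.openCarrier m) {s : ℝ} : setCoord j x s ∈ D.openCarrier m ↔ s ∈ D.openAxis := by
  refine ⟨fun h => by simpa [setCoord] using h j, fun hs i => ?_⟩
  rcases eq_or_ne i j with rfl | hij
  · simpa [setCoord] using hs
  · simpa [setCoord, hij] using hx i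

theorem setIntegral_eq_zero_of_lines {E : Type*} [NormedAddCommGroup E] [NormedSpace ℝ E]
    {j : Fin m} {F : EuclideanSpace ℝ (Fin m) → E} (hF : IntegrableOn F (D.openCarrier m))
    (h : ∀ x ∈ D.openCarrier m, IntegrableOn (fun s => F (setCoord j x s)) D.openAxis →
      ∫ s in D.openAxis, F (setCoord j x s) = 0) :
    ∫ x in D.openCarrier m, F x = 0 := by
  have hC := (D.isOpen_openCarrier m).measurableSet
  have hA := D.isOpen_openAxis.measurableSet
  rw [← integral_indicator hC]
  refine integral_eq_zero_of_lines j ((integrable_indicator_iff hC).2 hF) fun x hint => ?_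
  by_cases hx : ∃ s, setCoord j x s ∈ D.openCarrier m
  · obtain ⟨s₀, hs₀⟩ := hx
    have hline : (fun s => (D.openCarrier m).indicator F (setCoord j x s)) =
        D.openAxis.indicator fun s => F (setCoord j (setCoord j x s₀) s) := by
      ext s
      have hiff := D.setCoord_mem_openCarrier_iff hs₀ (j := j) (s := s)
      rw [setCoord_setCoord] at hiff
      simp only [setCoord_setCoord]
      exact Set.indicator_eq_indicator hiff rfl
    rw [hline] at hint ⊢
    rw [integral_indicator hA]
    exact h _ hs₀ ((integrable_indicator_iff hA).1 hint)
  · simp only [Set.indicator_of_notMem (not_exists.1 hx _), integral_zero]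

theorem setIntegral_eq_zero_of_hasDerivAt_lines {j : Fin m} {f F : EuclideanSpace ℝ (Fin m) → ℝ}
    (hac : ∀ x ∈ D.openCarrier m, ∀ c ∈ D.openAxis, ∀ d ∈ D.openAxis,
      AbsolutelyContinuousOnInterval (fun s => f (setCoord j x s)) c d)
    (hderiv : ∀ x ∈ D.openCarrier m, ∀ᵐ s, s ∈ D.openAxis →
      HasDerivAt (fun c => f (setCoord j x c)) (F (setCoord j x s)) s)
    (hlim : ∀ x ∈ D.openCarrier m, ∃ l, Tendsto (fun s => f (setCoord j x s)) atTop (𝓝 l) ∧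
      Tendsto (fun s => f (setCoord j x s)) D.lowerEnd (𝓝 l))
    (hF : IntegrableOn F (D.openCarrier m)) :
    ∫ x in D.openCarrier m, F x = 0 := by
  refine D.setIntegral_eq_zero_of_lines (j := j) hF fun x hx hint => ?_
  have hae : (fun s => F (setCoord j x s)) =ᵐ[volume.restrict D.openAxis]
      deriv fun c => f (setCoord j x c) := by
    refine (ae_restrict_iff' D.isOpen_openAxis.measurableSet).2 ?_
    exact (hderiv x hx).mono fun s hs hsa => (hs hsa).deriv.symm
  obtain ⟨l, htop, hlow⟩ := hlim x hx
  rw [integral_congr_ae hae]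
  exact D.integral_deriv_eq_zero (hac x hx) (hint.congr hae) htop hlow

end SampleSpace

/-! ### Score matching -/

theorem contDiffOn_pd {m : ℕ} {F : Type*} [NormedAddCommGroup F] [NormedSpace ℝ F] (j : Fin m)
    {f : EuclideanSpace ℝ (Fin m) → F} {s : Set (EuclideanSpace ℝ (Fin m))} (hs : IsOpen s)
    {k l : WithTop ℕ∞} (hf : ContDiffOn ℝ l f s) (hkl : k + 1 ≤ l) :
    ContDiffOn ℝ k (pd j f) s := by
  have hl : l ≠ 0 := fun h => by simp [h] at hkl
  have hfderiv : ContDiffOn ℝ k (fun x => fderiv ℝ f x (EuclideanSpace.single j 1)) s :=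
    (hf.fderiv_of_isOpen hs hkl).clm_apply contDiffOn_const
  exact hfderiv.congr fun x hx =>
    ((hf.differentiableOn hl).differentiableAt (hs.mem_nhds hx)).lineDeriv_eq_fderiv

theorem pd_inner_sub_add {m : ℕ} {E : Type*} [NormedAddCommGroup E] [InnerProductSpace ℝ E]
    {f : EuclideanSpace ℝ (Fin m) → E} {g : EuclideanSpace ℝ (Fin m) → ℝ}
    {x : EuclideanSpace ℝ (Fin m)} (hf : DifferentiableAt ℝ f x) (hg : DifferentiableAt ℝ g x)
    (j : Fin m) (θ : E) (c : ℝ) :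
    pd j (fun y => inner ℝ θ (f y) - c + g y) x = inner ℝ θ (pd j f x) + pd j g x := by
  have hsum : HasFDerivAt (fun y => inner ℝ θ (f y) - c + g y)
      ((innerSL ℝ θ).comp (fderiv ℝ f x) + fderiv ℝ g x) x :=
    (((innerSL ℝ θ).hasFDerivAt.comp x hf.hasFDerivAt).sub_const c).add hg.hasFDerivAt
  rw [pd, (hsum.hasLineDerivAt _).lineDeriv, pd, pd, hf.lineDeriv_eq_fderiv,
    hg.lineDeriv_eq_fderiv]
  rfl

theorem pd_eqOn {m : ℕ} {F : Type*} [NormedAddCommGroup F] [NormedSpace ℝ F] (j : Fin m)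
    {f g : EuclideanSpace ℝ (Fin m) → F} {s : Set (EuclideanSpace ℝ (Fin m))} (hs : IsOpen s)
    (h : Set.EqOn f g s) : Set.EqOn (pd j f) (pd j g) s := fun _ hx =>
  (h.eventuallyEq_of_mem (hs.mem_nhds hx)).lineDeriv_eq

theorem extend_val_single {ι R : Type*} [DecidableEq ι] [Zero R] {s : Set ι} (i : s) (c : R) :
    Function.extend Subtype.val (Pi.single i c) 0 = Pi.single i.1 c := by
  ext k
  by_cases hk : k ∈ s
  · rw [Subtype.val_injective.extend_apply _ _ (⟨k, hk⟩ : s)]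
    simp [Pi.single_apply, Subtype.ext_iff]
  · rw [Function.extend_apply' _ _ _ (by simpa using hk), Pi.zero_apply,
      Pi.single_eq_of_ne (by rintro rfl; exact hk i.2)]

theorem exists_eq_smul_sub_of_nonempty_interior {E : Type*} [NormedAddCommGroup E]
    [NormedSpace ℝ E] {S : Set E} (hS : (interior S).Nonempty) (u : E) :
    ∃ c : ℝ, ∃ θ ∈ S, ∃ θ' ∈ S, u = c • (θ - θ') := by
  obtain ⟨θ', hθ'⟩ := hS
  have hlim : Tendsto (fun c : ℝ => θ' + c • u) (𝓝[>] 0) (𝓝 θ') := by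
    have hcont : Continuous fun c : ℝ => θ' + c • u := by fun_prop
    simpa using (hcont.tendsto 0).mono_left nhdsWithin_le_nhds
  obtain ⟨c, hcS, hc⟩ := ((hlim.eventually (mem_interior_iff_mem_nhds.1 hθ')).and
    self_mem_nhdsWithin).exists
  refine ⟨c⁻¹, _, hcS, θ', interior_subset hθ', ?_⟩
  rw [add_sub_cancel_left, inv_smul_smul₀ (Set.mem_Ioi.1 hc).ne']

namespace ExpFamily

variable {m r : ℕ}

section Family

variable (M : ExpFamily m r)

/-- The family is minimal: no non-trivial linear combination of the components of the sufficient
statistic is constant on the interior of the sample space. -/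
def IsMinimal : Prop :=
  ∀ u ≠ 0, ∃ x ∈ M.openX, ∃ y ∈ M.openX, inner ℝ u (M.t x) ≠ inner ℝ u (M.t y)

/-- The `j`-th component `p(x | θ₀) h_j(x) uᵀ ∂_j t(x)` of the vector field to which integration by
parts is applied. -/
noncomputable def flux (θ₀ u : EuclideanSpace ℝ (Fin r)) (j : Fin m)
    (x : EuclideanSpace ℝ (Fin m)) : ℝ :=
  M.density θ₀ x * M.h j x * inner ℝ u (pd j M.t x)

/-- The quotient of `∂_j (p(x | θ₀) h_j(x) uᵀ ∂_j t(x))` by `p(x | θ₀)`. -/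
noncomputable def relFluxDeriv (θ₀ u : EuclideanSpace ℝ (Fin r)) (j : Fin m)
    (x : EuclideanSpace ℝ (Fin m)) : ℝ :=
  M.h j x * inner ℝ u (pd j M.t x) * pd j (M.logDensity θ₀) x +
    (pd j (M.h j) x * inner ℝ u (pd j M.t x) + M.h j x * inner ℝ u (pd j (pd j M.t) x))

/-- The mean of `Γ` under `P_θ₀`. -/
noncomputable def meanGam (θ₀ : EuclideanSpace ℝ (Fin r)) : Matrix (Fin r) (Fin r) ℝ :=
  Matrix.of fun i k => ∫ x, M.Gam x i k ∂M.law θ₀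

theorem isOpen_openX : IsOpen M.openX := M.space.isOpen_openCarrier m

theorem openX_subset : M.openX ⊆ M.X := M.space.openCarrier_subset m

theorem law_eq (θ : EuclideanSpace ℝ (Fin r)) :
    M.law θ = (volume.restrict M.openX).withDensity fun x => ENNReal.ofReal (M.density θ x) := by
  rw [law, X, openX, Measure.restrict_congr_set (M.space.openCarrier_ae_eq m)]

theorem law_absolutelyContinuous (θ : EuclideanSpace ℝ (Fin r)) :
    M.law θ ≪ volume.restrict M.openX := by
  rw [law_eq]
  exact withDensity_absolutelyContinuous _ _

theorem ae_mem_openX (θ : EuclideanSpace ℝ (Fin r)) : ∀ᵐ x ∂M.law θ, x ∈ M.openX :=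
  (M.law_absolutelyContinuous θ).ae_le (ae_restrict_mem M.isOpen_openX.measurableSet)

theorem isSymm_Gam (x : EuclideanSpace ℝ (Fin m)) : (M.Gam x).IsSymm := by
  simp only [Matrix.IsSymm, Gam, Matrix.transpose_sum, Matrix.transpose_smul,
    Matrix.transpose_vecMulVec]

theorem isSymm_meanGam (θ₀ : EuclideanSpace ℝ (Fin r)) : (M.meanGam θ₀).IsSymm :=
  Matrix.IsSymm.ext fun _ _ => integral_congr_ae <| ae_of_all _ fun x => (M.isSymm_Gam x).apply _ _

theorem dotProduct_Gam_mulVec (u w : EuclideanSpace ℝ (Fin r)) (x : EuclideanSpace ℝ (Fin m)) :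
    u.ofLp ⬝ᵥ (M.Gam x).mulVec w.ofLp =
      ∑ j, M.h j x * (inner ℝ u (pd j M.t x) * inner ℝ w (pd j M.t x)) := by
  rw [Gam, Matrix.sum_mulVec, dotProduct_sum]
  refine Finset.sum_congr rfl fun j _ => ?_
  rw [Matrix.smul_mulVec, Matrix.vecMulVec_mulVec, dotProduct_smul, op_smul_eq_smul,
    dotProduct_smul, smul_eq_mul, smul_eq_mul, dotProduct_comm u.ofLp]
  simp only [EuclideanSpace.inner_eq_star_dotProduct, star_trivial]
  ring

theorem Gam_apply (x : EuclideanSpace ℝ (Fin m)) (i k : Fin r) :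
    M.Gam x i k = (EuclideanSpace.single i (1 : ℝ)).ofLp ⬝ᵥ
      (M.Gam x).mulVec (EuclideanSpace.single k (1 : ℝ)).ofLp := by
  simp

theorem extend_v (j : Fin m) {x : EuclideanSpace ℝ (Fin m)} (hx : x ∈ M.openX) :
    Function.extend Subtype.val (M.v j x) 0 = √(M.h j x) • (pd j M.t x).ofLp := by
  ext i
  by_cases hi : i ∈ M.R j
  · exact Subtype.val_injective.extend_apply (M.v j x) 0 (⟨i, hi⟩ : M.R j)
  · have hzero : pd j M.t x i = 0 := by
      by_contra hne
      exact hi ⟨x, hx, hne⟩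
    rw [Function.extend_apply' _ _ _ (by simpa using hi), Pi.smul_apply, hzero, smul_zero,
      Pi.zero_apply]

theorem exists_inner_pd_ne_zero (hA2 : M.NullPreimages) {j : Fin m} {i : Fin r} (hj : i ∈ M.R j)
    {u : EuclideanSpace ℝ (Fin r)} (hi : u i ≠ 0) :
    ∃ x ∈ M.openX, inner ℝ u (pd j M.t x) ≠ 0 := by
  classical
  by_contra! hzero
  let L : Submodule ℝ (M.R j → ℝ) := LinearMap.ker
    (dotProductBilin ℝ ℝ u.ofLp ∘ₗ Function.ExtendByZero.linearMap ℝ Subtype.val)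
  have hmem : ∀ w, w ∈ L ↔ u.ofLp ⬝ᵥ Function.extend Subtype.val w 0 = 0 := fun _ => Iff.rfl
  have hL : L ≠ ⊤ := fun htop => by
    have hsingle := (hmem (Pi.single ⟨i, hj⟩ 1)).1 (htop ▸ Submodule.mem_top)
    rw [extend_val_single, dotProduct_single, mul_one] at hsingle
    exact hi hsingle
  have hsubset : M.openX ⊆ {x ∈ M.X | M.v j x ∈ L} := fun x hx => by
    refine ⟨M.openX_subset hx, (hmem _).2 ?_⟩
    rw [M.extend_v j hx, dotProduct_smul]
    rw [dotProduct_comm, ← star_trivial u.ofLp, ← EuclideanSpace.inner_eq_star_dotProduct,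
      hzero x hx, smul_zero]
  exact (M.isOpen_openX.measure_pos volume (M.space.nonempty_openCarrier m)).ne'
    (measure_mono_null hsubset (hA2 j L hL))

end Family

namespace ScoreMatchingRegular

variable {M : ExpFamily m r} {θ₀ : EuclideanSpace ℝ (Fin r)} (hM : M.ScoreMatchingRegular θ₀)

include hM

theorem differentiableAt_t {x : EuclideanSpace ℝ (Fin m)} (hx : x ∈ M.openX) :
    DifferentiableAt ℝ M.t x :=
  (hM.t_smooth.differentiableOn two_ne_zero).differentiableAt (M.isOpen_openX.mem_nhds hx)

theorem differentiableAt_b {x : EuclideanSpace ℝ (Fin m)} (hx : x ∈ M.openX) :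
    DifferentiableAt ℝ M.b x :=
  (hM.b_smooth.differentiableOn two_ne_zero).differentiableAt (M.isOpen_openX.mem_nhds hx)

theorem contDiffOn_pd_t (j : Fin m) : ContDiffOn ℝ 1 (pd j M.t) M.openX :=
  contDiffOn_pd j M.isOpen_openX hM.t_smooth one_add_one_eq_two.le

theorem contDiffOn_pd_b (j : Fin m) : ContDiffOn ℝ 1 (pd j M.b) M.openX :=
  contDiffOn_pd j M.isOpen_openX hM.b_smooth one_add_one_eq_two.le

theorem contDiffOn_logDensity (θ : EuclideanSpace ℝ (Fin r)) :
    ContDiffOn ℝ 2 (M.logDensity θ) M.openX :=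
  ((contDiffOn_const.inner ℝ hM.t_smooth).sub contDiffOn_const).add hM.b_smooth

theorem contDiffOn_density (θ : EuclideanSpace ℝ (Fin r)) :
    ContDiffOn ℝ 2 (M.density θ) M.openX :=
  (hM.contDiffOn_logDensity θ).exp

theorem pd_logDensity (θ : EuclideanSpace ℝ (Fin r)) (j : Fin m) {x : EuclideanSpace ℝ (Fin m)}
    (hx : x ∈ M.openX) :
    pd j (M.logDensity θ) x = inner ℝ θ (pd j M.t x) + pd j M.b x :=
  pd_inner_sub_add (hM.differentiableAt_t hx) (hM.differentiableAt_b hx) j θ _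

theorem pd_pd_logDensity (θ : EuclideanSpace ℝ (Fin r)) (j : Fin m)
    {x : EuclideanSpace ℝ (Fin m)} (hx : x ∈ M.openX) :
    pd j (pd j (M.logDensity θ)) x = inner ℝ θ (pd j (pd j M.t) x) + pd j (pd j M.b) x := by
  have hnhds := M.isOpen_openX.mem_nhds hx
  rw [← pd_inner_sub_add ((hM.contDiffOn_pd_t j).differentiableOn_one.differentiableAt hnhds)
    ((hM.contDiffOn_pd_b j).differentiableOn_one.differentiableAt hnhds) j θ 0]
  refine pd_eqOn j M.isOpen_openX (fun y hy => ?_) hx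
  rw [hM.pd_logDensity θ j hy, sub_zero]

theorem exists_inner_pd_eq (u : EuclideanSpace ℝ (Fin r)) :
    ∃ c : ℝ, ∃ θ ∈ M.naturalSpace, ∃ θ' ∈ M.naturalSpace, ∀ j, ∀ x ∈ M.openX,
      inner ℝ u (pd j M.t x) = c * (pd j (M.logDensity θ) x - pd j (M.logDensity θ') x) ∧
      inner ℝ u (pd j (pd j M.t) x) =
        c * (pd j (pd j (M.logDensity θ)) x - pd j (pd j (M.logDensity θ')) x) := by
  obtain ⟨c, θ, hθ, θ', hθ', rfl⟩ := exists_eq_smul_sub_of_nonempty_interior hM.full u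
  refine ⟨c, θ, hθ, θ', hθ', fun j x hx => ?_⟩
  simp only [hM.pd_logDensity _ j hx, hM.pd_pd_logDensity _ j hx, real_inner_smul_left,
    inner_sub_left, add_sub_add_right_eq_sub, and_self]

theorem exists_tendsto_flux (u : EuclideanSpace ℝ (Fin r)) (j : Fin m)
    {x : EuclideanSpace ℝ (Fin m)} (hx : x ∈ M.openX) :
    ∃ l, Tendsto (fun s => M.flux θ₀ u j (setCoord j x s)) atTop (𝓝 l) ∧
      Tendsto (fun s => M.flux θ₀ u j (setCoord j x s)) M.space.lowerEnd (𝓝 l) := by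
  obtain ⟨c, θ, hθ, θ', hθ', hu⟩ := hM.exists_inner_pd_eq u
  obtain ⟨l, htop, hlow⟩ := hM.boundary θ hθ j x hx
  obtain ⟨l', htop', hlow'⟩ := hM.boundary θ' hθ' j x hx
  have hflux : ∀ s ∈ M.space.openAxis, c *
      (M.density θ₀ (setCoord j x s) * M.h j (setCoord j x s) *
          pd j (M.logDensity θ) (setCoord j x s) -
        M.density θ₀ (setCoord j x s) * M.h j (setCoord j x s) *
          pd j (M.logDensity θ') (setCoord j x s)) = M.flux θ₀ u j (setCoord j x s) := by
    intro s hs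
    rw [flux, (hu j _ ((M.space.setCoord_mem_openCarrier_iff hx).2 hs)).1]
    ring
  exact ⟨c * (l - l'),
    ((htop.sub htop').const_mul c).congr' (M.space.eventually_atTop.mono fun s hs => hflux s hs.1),
    ((hlow.sub hlow').const_mul c).congr'
      (M.space.eventually_lowerEnd.mono fun s hs => hflux s hs.1)⟩

theorem hasDerivAt_flux (u : EuclideanSpace ℝ (Fin r)) (j : Fin m)
    {x : EuclideanSpace ℝ (Fin m)} {s : ℝ} (hs : setCoord j x s ∈ M.openX)
    (hh : DifferentiableAt ℝ (fun c => M.h j (setCoord j x c)) s) :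
    HasDerivAt (fun c => M.flux θ₀ u j (setCoord j x c))
      (M.density θ₀ (setCoord j x s) * M.relFluxDeriv θ₀ u j (setCoord j x s)) s := by
  have hnhds := M.isOpen_openX.mem_nhds hs
  have hlog : HasDerivAt (fun c => M.logDensity θ₀ (setCoord j x c))
      (pd j (M.logDensity θ₀) (setCoord j x s)) s :=
    hasDerivAt_comp_setCoord
      (((hM.contDiffOn_logDensity θ₀).differentiableOn two_ne_zero).differentiableAt hnhds)
  have hweight : HasDerivAt (fun c => M.h j (setCoord j x c)) (pd j (M.h j) (setCoord j x s)) s :=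
    pd_setCoord j (M.h j) x s ▸ hh.hasDerivAt
  have hstat : HasDerivAt (fun c => pd j M.t (setCoord j x c))
      (pd j (pd j M.t) (setCoord j x s)) s :=
    hasDerivAt_comp_setCoord ((hM.contDiffOn_pd_t j).differentiableOn_one.differentiableAt hnhds)
  refine ((hlog.exp.mul hweight).mul
    ((innerSL ℝ u).hasFDerivAt.comp_hasDerivAt s hstat)).congr_deriv ?_
  simp only [relFluxDeriv, density, innerSL_apply_apply, Pi.mul_apply, Function.comp_apply]
  ring

theorem absolutelyContinuousOnInterval_flux (u : EuclideanSpace ℝ (Fin r)) (j : Fin m)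
    {x : EuclideanSpace ℝ (Fin m)} (hx : x ∈ M.openX) {c d : ℝ} (hc : c ∈ M.space.openAxis)
    (hd : d ∈ M.space.openAxis) :
    AbsolutelyContinuousOnInterval (fun s => M.flux θ₀ u j (setCoord j x s)) c d := by
  have hmaps : Set.MapsTo (setCoord j x) (Set.uIcc c d) M.openX := fun s hs =>
    (M.space.setCoord_mem_openCarrier_iff hx).2 (M.space.uIcc_subset_openAxis hc hd hs)
  have hline : ContDiffOn ℝ 1 (setCoord j x) (Set.uIcc c d) := (contDiff_setCoord j x).contDiffOn
  have hdensity : ContDiffOn ℝ 1 (fun s => M.density θ₀ (setCoord j x s)) (Set.uIcc c d) :=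
    ((hM.contDiffOn_density θ₀).of_le one_le_two).comp hline hmaps
  have hstat : ContDiffOn ℝ 1 (fun s => inner ℝ u (pd j M.t (setCoord j x s))) (Set.uIcc c d) :=
    contDiffOn_const.inner ℝ ((hM.contDiffOn_pd_t j).comp hline hmaps)
  exact (hdensity.absolutelyContinuousOnInterval.fun_mul (hM.h_absCont j x hx c hc d hd)).fun_mul
    hstat.absolutelyContinuousOnInterval

theorem aemeasurable_density (θ : EuclideanSpace ℝ (Fin r)) :
    AEMeasurable (fun x => ENNReal.ofReal (M.density θ x)) (volume.restrict M.openX) :=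
  ((hM.contDiffOn_density θ).continuousOn.aemeasurable
    M.isOpen_openX.measurableSet).ennreal_ofReal

theorem absolutelyContinuous_law (θ : EuclideanSpace ℝ (Fin r)) :
    volume.restrict M.openX ≪ M.law θ := by
  rw [law_eq]
  exact withDensity_absolutelyContinuous' (hM.aemeasurable_density θ) <| ae_of_all _ fun _ =>
    (ENNReal.ofReal_pos.2 (Real.exp_pos _)).ne'

theorem integrable_law_iff (θ : EuclideanSpace ℝ (Fin r)) {f : EuclideanSpace ℝ (Fin m) → ℝ} :
    Integrable f (M.law θ) ↔ IntegrableOn (fun x => M.density θ x * f x) M.openX := by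
  rw [law_eq, integrable_withDensity_iff_integrable_smul₀' (hM.aemeasurable_density θ)
    (ae_of_all _ fun _ => ENNReal.ofReal_lt_top)]
  simp only [density, ENNReal.toReal_ofReal (Real.exp_nonneg _), smul_eq_mul, IntegrableOn]

theorem integral_law (θ : EuclideanSpace ℝ (Fin r)) (f : EuclideanSpace ℝ (Fin m) → ℝ) :
    ∫ x, f x ∂M.law θ = ∫ x in M.openX, M.density θ x * f x := by
  rw [law_eq, integral_withDensity_eq_integral_toReal_smul₀ (hM.aemeasurable_density θ)
    (ae_of_all _ fun _ => ENNReal.ofReal_lt_top)]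
  simp only [density, ENNReal.toReal_ofReal (Real.exp_nonneg _), smul_eq_mul]

theorem ae_h_nonneg (j : Fin m) : ∀ᵐ x ∂M.law θ₀, 0 ≤ M.h j x :=
  (M.ae_mem_openX θ₀).mono fun x hx => hM.h_nonneg j x (M.openX_subset hx)

theorem ae_h_pos (j : Fin m) : ∀ᵐ x ∂volume.restrict M.openX, 0 < M.h j x :=
  ae_restrict_of_ae_restrict_of_subset M.openX_subset (hM.h_pos j)

theorem memLp_sqrt_h_mul_score {θ : EuclideanSpace ℝ (Fin r)} (hθ : θ ∈ M.naturalSpace)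
    (j : Fin m) :
    MemLp (fun x => √(M.h j x) * pd j (M.logDensity θ) x) 2 (M.law θ₀) := by
  have hscore : AEStronglyMeasurable (pd j (M.logDensity θ)) (M.law θ₀) :=
    ((contDiffOn_pd j M.isOpen_openX (hM.contDiffOn_logDensity θ)
      one_add_one_eq_two.le).continuousOn.aestronglyMeasurable
        M.isOpen_openX.measurableSet).mono_ac (M.law_absolutelyContinuous θ₀)
  refine (memLp_two_iff_integrable_sq
    ((hM.h_meas j).sqrt.aestronglyMeasurable.mul hscore)).2 ((hM.score_sq θ hθ j).congr ?_)
  filter_upwards [hM.ae_h_nonneg j] with x hx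
  rw [Pi.mul_apply, mul_pow, Real.sq_sqrt hx]

theorem memLp_sqrt_h_mul_inner (u : EuclideanSpace ℝ (Fin r)) (j : Fin m) :
    MemLp (fun x => √(M.h j x) * inner ℝ u (pd j M.t x)) 2 (M.law θ₀) := by
  obtain ⟨c, θ, hθ, θ', hθ', hu⟩ := hM.exists_inner_pd_eq u
  refine (((hM.memLp_sqrt_h_mul_score hθ j).sub (hM.memLp_sqrt_h_mul_score hθ' j)).const_mul
    c).ae_eq ?_
  filter_upwards [M.ae_mem_openX θ₀] with x hx
  rw [(hu j x hx).1, Pi.sub_apply]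
  ring

theorem integrable_h_mul {f g : EuclideanSpace ℝ (Fin m) → ℝ} {j : Fin m}
    (hf : MemLp (fun x => √(M.h j x) * f x) 2 (M.law θ₀))
    (hg : MemLp (fun x => √(M.h j x) * g x) 2 (M.law θ₀)) :
    Integrable (fun x => M.h j x * (f x * g x)) (M.law θ₀) := by
  refine (hf.integrable_mul hg).congr ?_
  filter_upwards [hM.ae_h_nonneg j] with x hx
  rw [Pi.mul_apply, mul_mul_mul_comm, Real.mul_self_sqrt hx]

theorem integrable_relFluxDeriv (u : EuclideanSpace ℝ (Fin r)) (j : Fin m) :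
    Integrable (M.relFluxDeriv θ₀ u j) (M.law θ₀) := by
  have hscore : Integrable
      (fun x => M.h j x * inner ℝ u (pd j M.t x) * pd j (M.logDensity θ₀) x) (M.law θ₀) := by
    simpa only [mul_assoc] using
      hM.integrable_h_mul (hM.memLp_sqrt_h_mul_inner u j) (hM.memLp_sqrt_h_mul_score hM.mem j)
  obtain ⟨c, θ, hθ, θ', hθ', hu⟩ := hM.exists_inner_pd_eq u
  refine hscore.add ((((hM.score_deriv θ hθ j).sub (hM.score_deriv θ' hθ' j)).const_mul
    c).congr ?_)
  filter_upwards [M.ae_mem_openX θ₀] with x hx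
  rw [(hu j x hx).1, (hu j x hx).2, Pi.sub_apply]
  ring

theorem integral_relFluxDeriv (u : EuclideanSpace ℝ (Fin r)) (j : Fin m) :
    ∫ x, M.relFluxDeriv θ₀ u j x ∂M.law θ₀ = 0 := by
  rw [hM.integral_law]
  refine M.space.setIntegral_eq_zero_of_hasDerivAt_lines (j := j) (f := M.flux θ₀ u j)
    (fun x hx c hc d hd => hM.absolutelyContinuousOnInterval_flux u j hx hc hd)
    (fun x hx => ?_) (fun x hx => hM.exists_tendsto_flux u j hx)
    ((hM.integrable_law_iff θ₀).1 (hM.integrable_relFluxDeriv u j))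
  filter_upwards [ae_differentiableAt_of_absolutelyContinuousOnInterval M.space.isOpen_openAxis
    (hM.h_absCont j x hx)] with s hs hsA
  exact hM.hasDerivAt_flux u j ((M.space.setCoord_mem_openCarrier_iff hx).2 hsA) (hs hsA)

theorem dotProduct_Gam_mulVec_sub_inner_gvec (u : EuclideanSpace ℝ (Fin r))
    {x : EuclideanSpace ℝ (Fin m)} (hx : x ∈ M.openX) :
    u.ofLp ⬝ᵥ (M.Gam x).mulVec θ₀.ofLp - inner ℝ u (M.gvec x) =
      ∑ j, M.relFluxDeriv θ₀ u j x := by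
  rw [dotProduct_Gam_mulVec, gvec, inner_neg_right, inner_sum, sub_neg_eq_add,
    ← Finset.sum_add_distrib]
  refine Finset.sum_congr rfl fun j _ => ?_
  rw [relFluxDeriv, hM.pd_logDensity θ₀ j hx]
  simp only [inner_add_right, real_inner_smul_right]
  ring

theorem integrable_dotProduct_Gam_mulVec (u w : EuclideanSpace ℝ (Fin r)) :
    Integrable (fun x => u.ofLp ⬝ᵥ (M.Gam x).mulVec w.ofLp) (M.law θ₀) := by
  simp only [dotProduct_Gam_mulVec]
  exact integrable_finsetSum _ fun j _ =>
    hM.integrable_h_mul (hM.memLp_sqrt_h_mul_inner u j) (hM.memLp_sqrt_h_mul_inner w j)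

theorem integrable_Gam_apply (i k : Fin r) : Integrable (fun x => M.Gam x i k) (M.law θ₀) := by
  simp only [Gam_apply]
  exact hM.integrable_dotProduct_Gam_mulVec _ _

theorem integrable_vecMatrix_Gam : Integrable (fun x => vecMatrix (M.Gam x)) (M.law θ₀) :=
  .of_eval_piLp fun q => hM.integrable_Gam_apply q.1 q.2

theorem integrable_inner_gvec (u : EuclideanSpace ℝ (Fin r)) :
    Integrable (fun x => inner ℝ u (M.gvec x)) (M.law θ₀) := by
  refine ((hM.integrable_dotProduct_Gam_mulVec u θ₀).sub
    (integrable_finsetSum Finset.univ fun j _ => hM.integrable_relFluxDeriv u j)).congr ?_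
  filter_upwards [M.ae_mem_openX θ₀] with x hx
  rw [Pi.sub_apply, ← hM.dotProduct_Gam_mulVec_sub_inner_gvec u hx, sub_sub_cancel]

theorem integrable_gvec : Integrable M.gvec (M.law θ₀) :=
  .of_eval_piLp fun i => by
    simpa [EuclideanSpace.inner_single_left] using
      hM.integrable_inner_gvec (EuclideanSpace.single i 1)

theorem integral_vecMatrix_Gam :
    ∫ x, vecMatrix (M.Gam x) ∂M.law θ₀ = vecMatrix (M.meanGam θ₀) := by
  ext q
  exact eval_integral_piLp (fun q => hM.integrable_Gam_apply q.1 q.2) q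

theorem dotProduct_meanGam_mulVec (u w : EuclideanSpace ℝ (Fin r)) :
    u.ofLp ⬝ᵥ (M.meanGam θ₀).mulVec w.ofLp =
      ∫ x, u.ofLp ⬝ᵥ (M.Gam x).mulVec w.ofLp ∂M.law θ₀ := by
  simp only [dotProduct_mulVec_eq_inner, ← hM.integral_vecMatrix_Gam]
  exact (integral_inner hM.integrable_vecMatrix_Gam _).symm

theorem integral_gvec :
    ∫ x, M.gvec x ∂M.law θ₀ = WithLp.toLp 2 ((M.meanGam θ₀).mulVec θ₀.ofLp) := by
  refine ext_inner_left ℝ fun u => ?_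
  have hdiff : u.ofLp ⬝ᵥ (M.meanGam θ₀).mulVec θ₀.ofLp - ∫ x, inner ℝ u (M.gvec x) ∂M.law θ₀ =
      0 := by
    rw [hM.dotProduct_meanGam_mulVec, ← integral_sub (hM.integrable_dotProduct_Gam_mulVec u θ₀)
      (hM.integrable_inner_gvec u), integral_congr_ae ((M.ae_mem_openX θ₀).mono fun x hx =>
        hM.dotProduct_Gam_mulVec_sub_inner_gvec u hx),
      integral_finsetSum _ fun j _ => hM.integrable_relFluxDeriv u j]
    exact Finset.sum_eq_zero fun j _ => hM.integral_relFluxDeriv u j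
  rw [← integral_inner hM.integrable_gvec, ← sub_eq_zero.1 hdiff,
    EuclideanSpace.inner_eq_star_dotProduct, star_trivial, dotProduct_comm]

theorem inner_t_eq_of_forall_inner_pd_eq_zero {u : EuclideanSpace ℝ (Fin r)}
    (hu : ∀ j, ∀ x ∈ M.openX, inner ℝ u (pd j M.t x) = 0) {x y : EuclideanSpace ℝ (Fin m)}
    (hx : x ∈ M.openX) (hy : y ∈ M.openX) : inner ℝ u (M.t x) = inner ℝ u (M.t y) := by
  have hderiv : ∀ z ∈ M.openX, HasFDerivAt (fun z => inner ℝ u (M.t z))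
      ((innerSL ℝ u).comp (fderiv ℝ M.t z)) z := fun z hz =>
    (innerSL ℝ u).hasFDerivAt.comp z (hM.differentiableAt_t hz).hasFDerivAt
  refine M.isOpen_openX.is_const_of_fderiv_eq_zero
    (M.space.convex_openCarrier m).isPreconnected
    (fun z hz => (hderiv z hz).differentiableAt.differentiableWithinAt) (fun z hz => ?_) hx hy
  rw [(hderiv z hz).fderiv]
  refine ContinuousLinearMap.coe_injective
    ((EuclideanSpace.basisFun (Fin m) ℝ).toBasis.ext fun j => ?_)
  simpa [pd, (hM.differentiableAt_t hz).lineDeriv_eq_fderiv] using hu j z hz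

theorem h_mul_inner_mul_self_nonneg (u : EuclideanSpace ℝ (Fin r)) (j : Fin m)
    {x : EuclideanSpace ℝ (Fin m)} (hx : x ∈ M.openX) :
    0 ≤ M.h j x * (inner ℝ u (pd j M.t x) * inner ℝ u (pd j M.t x)) :=
  mul_nonneg (hM.h_nonneg j x (M.openX_subset hx)) (mul_self_nonneg _)

theorem ae_dotProduct_Gam_mulVec_nonneg (u : EuclideanSpace ℝ (Fin r)) :
    0 ≤ᵐ[M.law θ₀] fun x => u.ofLp ⬝ᵥ (M.Gam x).mulVec u.ofLp := by
  filter_upwards [M.ae_mem_openX θ₀] with x hx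
  rw [dotProduct_Gam_mulVec]
  exact Finset.sum_nonneg fun j _ => hM.h_mul_inner_mul_self_nonneg u j hx

theorem inner_pd_eq_zero_of_dotProduct_meanGam_eq_zero {u : EuclideanSpace ℝ (Fin r)}
    (hu : u.ofLp ⬝ᵥ (M.meanGam θ₀).mulVec u.ofLp = 0) (j : Fin m) :
    ∀ x ∈ M.openX, inner ℝ u (pd j M.t x) = 0 := by
  have hquad : (fun x => u.ofLp ⬝ᵥ (M.Gam x).mulVec u.ofLp) =ᵐ[M.law θ₀] 0 := by
    rw [hM.dotProduct_meanGam_mulVec] at hu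
    exact (integral_eq_zero_iff_of_nonneg_ae (hM.ae_dotProduct_Gam_mulVec_nonneg u)
      (hM.integrable_dotProduct_Gam_mulVec u u)).1 hu
  have hae : (fun x => inner ℝ u (pd j M.t x)) =ᵐ[volume.restrict M.openX] 0 := by
    filter_upwards [(hM.absolutelyContinuous_law θ₀).ae_le hquad, hM.ae_h_pos j,
      ae_restrict_mem M.isOpen_openX.measurableSet] with x hquad_x hpos hx
    rw [dotProduct_Gam_mulVec, Pi.zero_apply,
      Finset.sum_eq_zero_iff_of_nonneg fun j _ => hM.h_mul_inner_mul_self_nonneg u j hx] at hquad_x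
    exact mul_self_eq_zero.1 ((mul_eq_zero.1 (hquad_x j (Finset.mem_univ j))).resolve_left hpos.ne')
  exact Measure.eqOn_open_of_ae_eq hae M.isOpen_openX
    (continuousOn_const.inner (hM.contDiffOn_pd_t j).continuousOn) continuousOn_const

theorem posDef_meanGam (hmin : M.IsMinimal) : (M.meanGam θ₀).PosDef := by
  refine Matrix.PosDef.of_dotProduct_mulVec_pos
    (Matrix.isHermitian_iff_isSymm.2 (M.isSymm_meanGam θ₀)) fun {u} hu => ?_
  have hnonneg : 0 ≤ u ⬝ᵥ (M.meanGam θ₀).mulVec u :=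
    (hM.dotProduct_meanGam_mulVec (WithLp.toLp 2 u) (WithLp.toLp 2 u)).symm ▸
      integral_nonneg_of_ae (hM.ae_dotProduct_Gam_mulVec_nonneg (WithLp.toLp 2 u))
  rw [star_trivial]
  refine hnonneg.lt_of_ne' fun hzero => ?_
  obtain ⟨x, hx, y, hy, hne⟩ := hmin (WithLp.toLp 2 u) (by simpa using hu)
  exact hne (hM.inner_t_eq_of_forall_inner_pd_eq_zero
    (fun j => hM.inner_pd_eq_zero_of_dotProduct_meanGam_eq_zero hzero j) hx hy)

theorem exists_mem_R (hA1 : M.NonconstantStatistic) (i : Fin r) : ∃ j, i ∈ M.R j := by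
  by_contra! hR
  have hpd : ∀ j, ∀ x ∈ M.openX,
      inner ℝ (EuclideanSpace.single i (1 : ℝ)) (pd j M.t x) = 0 := fun j x hx => by
    by_contra hne
    exact hR j ⟨x, hx, by simpa [EuclideanSpace.inner_single_left] using hne⟩
  obtain ⟨x, hx, y, hy, hne⟩ := hA1 i
  exact hne (by simpa [EuclideanSpace.inner_single_left] using
    hM.inner_t_eq_of_forall_inner_pd_eq_zero hpd hx hy)

theorem isMinimal (hA1 : M.NonconstantStatistic) (hA2 : M.NullPreimages) : M.IsMinimal := by
  intro u hu
  obtain ⟨i, hi⟩ : ∃ i, u i ≠ 0 := by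
    by_contra! hzero
    exact hu (PiLp.ext hzero)
  obtain ⟨j, hj⟩ := hM.exists_mem_R hA1 i
  obtain ⟨x, hx, hne⟩ := M.exists_inner_pd_ne_zero hA2 hj hi
  by_contra! hconst
  have hzero : Set.EqOn (fun y => inner ℝ u (M.t y) - inner ℝ u (M.t x) + 0) (fun _ => 0)
      M.openX := fun y hy => by simp only [hconst y hy x hx, sub_self, add_zero]
  have hpd := pd_eqOn j M.isOpen_openX hzero hx
  rw [pd_inner_sub_add (hM.differentiableAt_t hx) (differentiableAt_const 0)] at hpd
  exact hne (add_eq_right.1 hpd)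

end ScoreMatchingRegular

end ExpFamily

end RobustSM

open RobustSM in
theorem corollary3p2_general {m r : ℕ} {M : ExpFamily m r}
    {θ₀ : EuclideanSpace ℝ (Fin r)} (hM : M.ScoreMatchingRegular θ₀) (hmin : M.IsMinimal)
    {Ω : Type*} [MeasurableSpace Ω] {μ : Measure Ω} [IsProbabilityMeasure μ]
    {X : ℕ → Ω → EuclideanSpace ℝ (Fin m)} (hX : iIndepFun X μ)
    (hlaw : ∀ i, HasLaw (X i) (M.law θ₀) μ) {k nc : ℕ → ℕ}
    (hk : Tendsto (fun n => n / k n) atTop atTop) {α : ℝ} (hα : α < 1 / 2)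
    (hnc : ∀ᶠ n in atTop, (nc n : ℝ) ≤ α * k n)
    {Y : (n : ℕ) → Fin n → Ω → EuclideanSpace ℝ (Fin m)}
    (hY : ∀ n, ∀ᵐ ω ∂μ, {i : Fin n | Y n i ω ≠ X i ω}.ncard ≤ nc n)
    {Gh : ℕ → Ω → Matrix (Fin r) (Fin r) ℝ} {gh : ℕ → Ω → EuclideanSpace ℝ (Fin r)}
    (hGh : ∀ n ω, IsGMoM (k n) (fun i => vecMatrix (M.Gam (Y n i ω)))
      (vecMatrix (Gh n ω)))
    (hgh : ∀ n ω, IsGMoM (k n) (fun i => M.gvec (Y n i ω)) (gh n ω)) :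
    (∀ᶠ n in atTop, 1 ≤ k n ∧ k n ≤ n) ∧
    Tendsto (fun n => μ {ω | ¬ (Gh n ω).PosDef}) atTop (𝓝 0) ∧
    TendstoInMeasure μ (fun n ω => invMul (Gh n ω) (gh n ω)) atTop (fun _ => θ₀) ∧
    (∀ ε : ℝ, 0 < ε → Tendsto (fun n => μ {ω | ∃ θ,
      IsLossMin M.naturalSpace (Gh n ω) (gh n ω) θ ∧ ε ≤ dist θ θ₀}) atTop (𝓝 0)) ∧
    (θ₀ ∈ interior M.naturalSpace → Tendsto (fun n => μ {ω | ¬ ∀ θ,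
      IsLossMin M.naturalSpace (Gh n ω) (gh n ω) θ ↔
        θ = invMul (Gh n ω) (gh n ω)}) atTop (𝓝 0)) := by
  have hblocks := eventually_block_number_admissible hk
  have hΓ := hM.posDef_meanGam hmin
  have hG := tendsto_of_isGMoM_comp hM.integrable_vecMatrix_Gam hX hlaw hk hα hnc hY hGh
  rw [hM.integral_vecMatrix_Gam] at hG
  replace hG := tendsto_of_tendsto_vecMatrix hG
  have hg := tendsto_of_isGMoM_comp hM.integrable_gvec hX hlaw hk hα hnc hY hgh
  rw [hM.integral_gvec] at hg
  have hsymm : ∀ᶠ p : ℕ × Ω in whp μ atTop, (Gh p.1 p.2).IsSymm :=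
    eventually_whp_of_ae <| hblocks.mono fun n hn => ae_of_all _ fun ω =>
      (hGh n ω).isSymm hn.1 fun _ => M.isSymm_Gam _
  have hpos := eventually_posDef hΓ hG hsymm
  have hlim := tendsto_invMul hΓ hG hsymm hg
  refine ⟨hblocks, eventually_whp.1 hpos, tendstoInMeasure_const_iff.2 hlim,
    fun ε hε => ?_, fun hθ₀ => ?_⟩
  · have hdist : ∀ᶠ p : ℕ × Ω in whp μ atTop, ¬ ∃ θ,
        IsLossMin M.naturalSpace (Gh p.1 p.2) (gh p.1 p.2) θ ∧ ε ≤ dist θ θ₀ :=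
      (eventually_dist_lt_of_quadLoss_le hΓ hG hsymm hg hε).mono
        fun _ hp ⟨θ, hθ, hθε⟩ => (hp θ (hθ.2 θ₀ hM.mem)).not_ge hθε
    simpa only [eventually_whp, not_not] using hdist
  · have hiff : ∀ᶠ p : ℕ × Ω in whp μ atTop, ∀ θ,
        IsLossMin M.naturalSpace (Gh p.1 p.2) (gh p.1 p.2) θ ↔
          θ = invMul (Gh p.1 p.2) (gh p.1 p.2) := by
      filter_upwards [hpos, hlim.eventually_mem (mem_interior_iff_mem_nhds.1 hθ₀)] with p hp hmem
      exact isLossMin_iff_eq_invMul hp hmem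
    exact eventually_whp.1 hiff

/-- The number of blocks `K c` is a function of the number `c` of corrupted samples alone. For each
sample size `n`, `Y n` is the corrupted sample, which may differ arbitrarily from the i.i.d. sample
`X 0, …, X (n - 1)` in up to `nc n` observations; `Gh n` and `gh n` are any versions of the
geometric medians of means of `Γ` and `g` over the corrupted sample. -/
theorem corollary3p2 :
    ∃ K : ℕ → ℕ, ∀ (m r : ℕ) (M : RobustSM.ExpFamily m r) (θ₀ : EuclideanSpace ℝ (Fin r)),
      M.ScoreMatchingRegular θ₀ → M.NonconstantStatistic → M.NullPreimages →
      M.SecondMoments θ₀ →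
      ∀ (Ω : Type*) [MeasurableSpace Ω] (μ : Measure Ω) [IsProbabilityMeasure μ]
        (X : ℕ → Ω → EuclideanSpace ℝ (Fin m)),
        iIndepFun X μ → (∀ i, HasLaw (X i) (M.law θ₀) μ) →
      ∀ nc : ℕ → ℕ, (fun n => (nc n : ℝ)) =o[atTop] (fun n => (n : ℝ)) →
      ∀ Y : (n : ℕ) → Fin n → Ω → EuclideanSpace ℝ (Fin m),
        (∀ n, ∀ᵐ ω ∂μ, {i : Fin n | Y n i ω ≠ X i ω}.ncard ≤ nc n) →
      ∀ (Gh : ℕ → Ω → Matrix (Fin r) (Fin r) ℝ) (gh : ℕ → Ω → EuclideanSpace ℝ (Fin r)),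
        (∀ n ω, RobustSM.IsGMoM (K (nc n)) (fun i => RobustSM.vecMatrix (M.Gam (Y n i ω)))
          (RobustSM.vecMatrix (Gh n ω))) →
        (∀ n ω, RobustSM.IsGMoM (K (nc n)) (fun i => M.gvec (Y n i ω)) (gh n ω)) →
        -- the number of blocks is eventually admissible
        (∀ᶠ n in atTop, 1 ≤ K (nc n) ∧ K (nc n) ≤ n) ∧
        -- the matrix is positive definite with probability tending to one
        Tendsto (fun n => μ {ω | ¬ (Gh n ω).PosDef}) atTop (𝓝 0) ∧
        -- the estimator given by the inversion formula is consistent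
        TendstoInMeasure μ (fun n ω => RobustSM.invMul (Gh n ω) (gh n ω)) atTop (fun _ => θ₀) ∧
        -- all minimisers of the robust loss over the natural parameter space are consistent
        (∀ ε : ℝ, 0 < ε → Tendsto (fun n => μ {ω | ∃ θ,
          RobustSM.IsLossMin M.naturalSpace (Gh n ω) (gh n ω) θ ∧ ε ≤ dist θ θ₀})
          atTop (𝓝 0)) ∧
        -- if the true parameter is interior, then with probability tending to one the minimiser
        -- exists, is unique and is given by the inversion formula
        (θ₀ ∈ interior M.naturalSpace → Tendsto (fun n => μ {ω | ¬ ∀ θ,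
          RobustSM.IsLossMin M.naturalSpace (Gh n ω) (gh n ω) θ ↔
            θ = RobustSM.invMul (Gh n ω) (gh n ω)}) atTop (𝓝 0)) :=
  ⟨fun c => 4 * c + 1, fun _ _ _ _ hM hA1 hA2 _ _ _ _ _ _ hX hlaw _ hnc _ hY _ _ hGh hgh =>
    corollary3p2_general hM (hM.isMinimal hA1 hA2) hX hlaw (RobustSM.tendsto_block_size hnc)
      (α := 1 / 4) (by norm_num) (.of_forall fun n => by push_cast; linarith) hY hGh hgh⟩
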